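/- Let $n\ge 1$, let $\lambda=(\lambda_1,\dots,\lambda_k)$ be a tuple of positive integers with $\lambda_1+\dots+\lambda_k=n$, and let $P$ be a partition of the set $\{1,\dots,k\}$ into $|P|$ nonempty subsets. Let $SG_\lambda^P\le SO(n)$ be the group of all block-diagonal orthogonal matrices $A_1\oplus\dots\oplus A_k$, $A_j\in O(\lambda_j)$, such that $\prod_{j\in\alpha}\det A_j=1$ for every $\alpha\in P$, and let $F\ell(\lambda;P)=SO(n)/SG_\lambda^P$. Give $SO(n)$ the bi-invariant Riemannian metric equal to $\langle X,Y\rangle=\tfrac12\operatorname{tr}(X^{T}Y)$ on skew-symmetric matrices (so that the rotation by the angle $\theta\in[0,\pi]$ in a coordinate plane has distance $\theta$ from the identity), and give $F\ell(\lambda;P)$ the metric that makes $SO(n)\to F\ell(\lambda;P)$ a Riemannian submersion. The Riemannian volume measure of $F\ell(\lambda;P)$ is the unique Borel measure that has the density $\sqrt{\det(g_{st})}$ with respect to Lebesgue measure in smooth local coordinates, where $(g_{st})$ is the matrix of the metric; $\operatorname{Vol}$ denotes its total mass. (If $F\ell(\lambda;P)$ is a point, this is the unit mass.) Let $V_i=\operatorname{Vol}(\mathbb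 S^{i-1})$ be the surface measure of the unit sphere in $\mathbb R^i$ (so $V_1=2$), and let $\bar\lambda$ be the conjugate of the partition of $n$ obtained by sorting $\lambda$ in decreasing order, that is, the partition read off from the transposed Young diagram, continued by zeros to length $n$. Write $\mathbb 1=(1,\dots,1)$ and $V^{\mu}=V_1^{\mu_1}\cdots V_n^{\mu_n}$ for $\mu\in\mathbb Z^n$. Then this measure exists, and \[ \operatorname{Vol}(F\ell(\lambda;P)) \;=\; 2^{|P|-1}\,\frac{V_1V_2\cdots V_n}{\prod_{j=1}^{k}\prod_{i=1}^{\lambda_j}V_i}\;=\;2^{|P|-1}\,\frac{V^{\mathbb 1}}{V^{\bar\lambda}}\;=\;2^{|P|-1}\,V^{\mathbb 1-\bar\lambda}. \] -/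

import Mathlib

open scoped ContDiff Matrix

noncomputable section

namespace PartialFlag

/-- The special orthogonal group `SO(n)`. -/
abbrev SO (n : ℕ) : Type := Matrix.specialOrthogonalGroup (Fin n) ℝ

/-- `A` is block diagonal for the ordered partition `c` of `n`: the coordinates `0, …, n - 1` are
cut into consecutive blocks of sizes `c.blocksFun 0, c.blocksFun 1, …`, and `c.index i` is the
block that contains the coordinate `i`. -/
def IsBlockDiagonal {n : ℕ} (c : Composition n) (A : Matrix (Fin n) (Fin n) ℝ) : Prop :=
  ∀ i j, c.index i ≠ c.index j → A i j = 0

/-- For a set `α` of blocks, the square submatrix of `A` formed by the coordinates that lie in the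
blocks of `α`. -/
def blockPart {n : ℕ} (c : Composition n) (α : Finset (Fin c.length))
    (A : Matrix (Fin n) (Fin n) ℝ) :
    Matrix {i : Fin n // c.index i ∈ α} {i : Fin n // c.index i ∈ α} ℝ :=
  A.submatrix Subtype.val Subtype.val

theorem blockPart_one {n : ℕ} (c : Composition n) (α : Finset (Fin c.length)) :
    blockPart c α 1 = 1 := by
  ext i j
  simp [blockPart, Matrix.one_apply, Subtype.ext_iff]

theorem blockPart_transpose {n : ℕ} (c : Composition n) (α : Finset (Fin c.length))
    (A : Matrix (Fin n) (Fin n) ℝ) : blockPart c α Aᵀ = (blockPart c α A)ᵀ := rfl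

theorem blockPart_mul {n : ℕ} (c : Composition n) (α : Finset (Fin c.length))
    {A : Matrix (Fin n) (Fin n) ℝ} (hA : IsBlockDiagonal c A) (B : Matrix (Fin n) (Fin n) ℝ) :
    blockPart c α (A * B) = blockPart c α A * blockPart c α B := by
  ext i j
  change ∑ k, A i k * B k j = ∑ k : {i : Fin n // c.index i ∈ α}, A i k * B k j
  rw [← Finset.sum_subtype (Finset.univ.filter fun k => c.index k ∈ α) (by simp)
    (fun k => A i k * B k j)]
  refine (Finset.sum_subset (Finset.filter_subset _ _) fun k _ hk => ?_).symm
  have hk' : c.index k ∉ α := by simpa using hk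
  rw [hA i k (fun h => hk' (h ▸ i.2)), zero_mul]

/-- The group `SG_λ^P = ∏_{α ∈ P} S(∏_{j ∈ α} O(λ_j))`, as a block diagonal subgroup of `SO(n)`:
the block diagonal matrices whose part on the blocks of `α` has determinant one, for every
member `α` of the set partition `P`. -/
def SG {n : ℕ} (c : Composition n) (P : Finpartition (Finset.univ : Finset (Fin c.length))) :
    Subgroup (SO n) where
  carrier := {A | IsBlockDiagonal c A.1 ∧ ∀ α ∈ P.parts, (blockPart c α A.1).det = 1}
  one_mem' := by
    refine ⟨fun i j h => ?_, fun α _ => ?_⟩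
    · have hij : i ≠ j := fun e => h (by rw [e])
      simp [hij]
    · simp [blockPart_one]
  mul_mem' := by
    rintro A B ⟨hA, hA'⟩ ⟨hB, hB'⟩
    refine ⟨fun i j h => ?_, fun α hα => ?_⟩
    · simp only [Submonoid.coe_mul, Matrix.mul_apply]
      refine Finset.sum_eq_zero fun k _ => ?_
      by_cases hik : c.index i = c.index k
      · rw [hB k j (hik ▸ h), mul_zero]
      · rw [hA i k hik, zero_mul]
    · rw [Submonoid.coe_mul, blockPart_mul c α hA, Matrix.det_mul, hA' α hα, hB' α hα, mul_one]
  inv_mem' := by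
    rintro A ⟨hA, hA'⟩
    have hinv : (A⁻¹).1 = A.1ᵀ := rfl
    refine ⟨fun i j h => ?_, fun α hα => ?_⟩
    · rw [hinv, Matrix.transpose_apply, hA j i h.symm]
    · rw [hinv, blockPart_transpose, Matrix.det_transpose, hA' α hα]

/-- The partially oriented flag manifold `Fℓ(λ; P) = SO(n) / SG_λ^P` (left cosets `Q · SG_λ^P`). -/
def Flag {n : ℕ} (c : Composition n)
    (P : Finpartition (Finset.univ : Finset (Fin c.length))) : Type :=
  SO n ⧸ SG c P

/-- The quotient map `SO(n) → Fℓ(λ; P)`. -/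
def proj {n : ℕ} (c : Composition n)
    (P : Finpartition (Finset.univ : Finset (Fin c.length))) (Q : SO n) : Flag c P :=
  QuotientGroup.mk (s := SG c P) Q

/-- The quotient topology. -/
instance {n : ℕ} (c : Composition n)
    (P : Finpartition (Finset.univ : Finset (Fin c.length))) : TopologicalSpace (Flag c P) :=
  inferInstanceAs (TopologicalSpace (SO n ⧸ SG c P))

/-- The Borel σ-algebra of the quotient topology. -/
instance {n : ℕ} (c : Composition n)
    (P : Finpartition (Finset.univ : Finset (Fin c.length))) : MeasurableSpace (Flag c P) :=
  borel (Flag c P)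

instance {n : ℕ} (c : Composition n)
    (P : Finpartition (Finset.univ : Finset (Fin c.length))) : BorelSpace (Flag c P) := ⟨rfl⟩

/-- The bi-invariant inner product `⟨X, Y⟩ = ½ tr(Xᵀ Y)` on skew-symmetric matrices, for which the
rotation by the angle `θ` in a plane has geodesic distance `|θ|` from the identity. -/
def rotInner {n : ℕ} (X Y : Matrix (Fin n) (Fin n) ℝ) : ℝ := (Xᵀ * Y).trace / 2

/-- The orthogonal projection of a skew-symmetric matrix to the orthogonal complement of the Lie
algebra of `SG_λ^P`. That Lie algebra consists of the block diagonal skew-symmetric matrices, so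
the projection deletes the diagonal blocks. -/
def horizontal {n : ℕ} (c : Composition n) (X : Matrix (Fin n) (Fin n) ℝ) :
    Matrix (Fin n) (Fin n) ℝ :=
  Matrix.of fun i j => if c.index i = c.index j then 0 else X i j

/-- The pairs `i < j` of coordinates in different blocks. Their number is
`n (n - 1) / 2 - ∑ j, λ_j (λ_j - 1) / 2`, the dimension of `Fℓ(λ; P)`. -/
abbrev CoordIndex {n : ℕ} (c : Composition n) : Type :=
  {p : Fin n × Fin n // p.1 < p.2 ∧ c.index p.1 ≠ c.index p.2}

/-- The coordinate space `ℝ^d` with `d = dim Fℓ(λ; P)`. -/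
abbrev Coord {n : ℕ} (c : Composition n) : Type := CoordIndex c → ℝ

/-- The matrix of the `s`-th partial derivatives at `u` of a map from `ℝ^d` to `SO(n)`. -/
def partialDeriv {n : ℕ} (c : Composition n) (ψ : Coord c → SO n) (u : Coord c)
    (s : CoordIndex c) : Matrix (Fin n) (Fin n) ℝ :=
  Matrix.of fun i j => fderiv ℝ (fun v : Coord c => (ψ v).1 i j) u (Pi.single s 1)

/-- The matrix `g_{st}` at `u` of the Riemannian submersion metric of `Fℓ(λ; P)`, in the
coordinates given by the map `proj ∘ ψ`. The derivative `∂_s ψ` is a tangent vector of `SO(n)` at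
`Q = ψ u`, equal to `Q X` for the skew-symmetric matrix `X = Qᵀ ∂_s ψ`; the fibre of the quotient
map through `Q` is `Q · SG_λ^P`, so the horizontal part of `Q X` is `Q · horizontal X`. -/
def metricMatrix {n : ℕ} (c : Composition n) (ψ : Coord c → SO n) (u : Coord c) :
    Matrix (CoordIndex c) (CoordIndex c) ℝ :=
  Matrix.of fun s t =>
    rotInner (horizontal c ((ψ u).1ᵀ * partialDeriv c ψ u s))
      (horizontal c ((ψ u).1ᵀ * partialDeriv c ψ u t))

/-- A smooth local parametrization of `Fℓ(λ; P)`, given through a smooth lift to `SO(n)`: an open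
set `source` of `ℝ^d` and a smooth map `lift` from it to `SO(n)` whose composition with the
quotient map is an injective immersion. As the quotient map is a submersion, every smooth local
parametrization of `Fℓ(λ; P)` is of this form near each of its points. Nothing is said of `lift`
outside `source`. -/
structure LocalParam {n : ℕ} (c : Composition n)
    (P : Finpartition (Finset.univ : Finset (Fin c.length))) where
  source : Set (Coord c)
  isOpen_source : IsOpen source
  lift : Coord c → SO n
  smooth : ∀ i j, ContDiffOn ℝ ∞ (fun u => (lift u).1 i j) source
  injOn : Set.InjOn (fun u => proj c P (lift u)) source
  immersion : ∀ u ∈ source, (metricMatrix c lift u).det ≠ 0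

/-- `μ` is the Riemannian volume measure of `Fℓ(λ; P)` with the submersion metric: in every smooth
local parametrization it has the density `√(det g)` with respect to Lebesgue measure. -/
def IsRiemannianVolume {n : ℕ} (c : Composition n)
    (P : Finpartition (Finset.univ : Finset (Fin c.length)))
    (μ : MeasureTheory.Measure (Flag c P)) : Prop :=
  ∀ φ : LocalParam c P, ∀ B ⊆ φ.source, MeasurableSet B →
    μ ((fun u => proj c P (φ.lift u)) '' B) =
      ∫⁻ u in B, ENNReal.ofReal (√(metricMatrix c φ.lift u).det)

/-- `V_i = Vol(S^{i-1})`, the total surface measure of the unit sphere of `ℝ^i`, for `i ≥ 1`. -/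
def sphereVol (i : ℕ) : ℝ :=
  ((MeasureTheory.volume : MeasureTheory.Measure (EuclideanSpace ℝ (Fin i))).toSphere
    Set.univ).toReal

/-- The Young diagram whose row lengths are the parts of `c` in decreasing order. -/
def youngDiagram {n : ℕ} (c : Composition n) : YoungDiagram :=
  YoungDiagram.ofRowLens (c.blocks.insertionSort (· ≥ ·))
    (List.sortedGE_iff_pairwise.2 (List.pairwise_insertionSort (· ≥ ·) c.blocks))

/-- The `i`-th part, `i ≥ 1`, of the conjugate partition `λ̄`, continued by zeros: the length of
the `i`-th row of the transposed Young diagram. (Mathlib counts the rows from zero.) -/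
def conjPart {n : ℕ} (c : Composition n) (i : ℕ) : ℕ :=
  (youngDiagram c).transpose.rowLen (i - 1)

/-- The monomial `x^μ = x_1^{μ_1} ⋯ x_n^{μ_n}` with integer exponents. -/
def multiPow (n : ℕ) (x : ℕ → ℝ) (μ : ℕ → ℤ) : ℝ := ∏ i ∈ Finset.Icc 1 n, x i ^ μ i

end PartialFlag

end

/-! Take an `n × n` matrix `A` with independent Gaussian entries of density `exp (-π x²)`. With
probability 1/2 its determinant is positive, and then `A = Q T` with `Q ∈ SO(n)` and `T ∈ Tri c P`,
that is, `T` is block upper triangular with positive determinant on each member of `P`. Such a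
factorization exists by Gram-Schmidt (`exists_SO_mul_Tri`), and `Q` is unique up to a right factor
in `SG c P` (`mem_SG_of_mul_mem_Tri`), so `A` has a well-defined flag `flagOf c P A`.

For a lift `ψ` of a local parametrization, the map `(u, T) ↦ ψ(u) T` has Jacobian `√(det g(u)) ∏
|det T_jj| ^ m_j`, where `m_j` counts the coordinates after block `j` (`abs_det_chartDeriv`),
whereas the Gaussian density of `ψ(u) T` depends on `T` only. Hence the law of the flag is the
Riemannian volume times the constant `K = triangularMass`, the Gaussian mean of `∏ |det T_jj| ^ m_j`
under the sign conditions (`gauss_flagOf_preimage`). Dividing by `K` yields the volume measure, with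
total mass `1 / (2K)`. It is unique because the Cayley transform provides parametrizations around
every point (`exists_localParam`).

To find `K`: the block determinants are independent and symmetric, so each of the `|P|` sign
conditions halves the mean (`two_pow_mul_lintegral_signs`). Rotating one row onto an axis reduces a
Gaussian determinant of size `l` to one of size `l - 1`, and the mean of `|x| ^ m` in `ℝ^p` is `V_p
/ V_{p+m}`; so the `m`-th absolute moment of the determinant is `∏_{i ≤ l} V_i / V_{i+m}`
(`lintegral_detPow_detLaw`). Over the blocks these quotients telescope (`prod_tailCard`). -/

open scoped ContDiff Matrix

noncomputable section

namespace PartialFlag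

open MeasureTheory Set

/-! ### Gaussian measures: product structure and rotation invariance -/

section Gaussian

variable {ι κ : Type*} [Fintype ι] [Fintype κ]

/-- The Gaussian density `exp (-π |x|²)`, which has total mass one in every dimension. -/
def gaussDensity (x : ι → ℝ) : ENNReal := ENNReal.ofReal (Real.exp (-Real.pi * ∑ i, x i ^ 2))

/-- The Gaussian measure with density `exp (-π |x|²)`. -/
def gauss (ι : Type*) [Fintype ι] : Measure (ι → ℝ) := volume.withDensity gaussDensity

/-- The Gaussian measure of the real line with density `exp (-π x²)`. -/
def gaussLine : Measure ℝ :=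
  volume.withDensity fun x => ENNReal.ofReal (Real.exp (-Real.pi * x ^ 2))

theorem measurable_gaussDensity : Measurable (gaussDensity : (ι → ℝ) → ENNReal) := by
  unfold gaussDensity; fun_prop

theorem integrable_exp_neg_pi_mul_sq : Integrable fun x : ℝ => Real.exp (-Real.pi * x ^ 2) :=
  integrable_exp_neg_mul_sq Real.pi_pos

instance : IsProbabilityMeasure gaussLine := by
  constructor
  rw [gaussLine, withDensity_apply _ MeasurableSet.univ, Measure.restrict_univ,
    ← ofReal_integral_eq_lintegral_ofReal integrable_exp_neg_pi_mul_sq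
      (Filter.Eventually.of_forall fun x => (Real.exp_pos _).le), integral_gaussian]
  simp [Real.pi_ne_zero]

/-- The exponential turns the sum of squares into a product. The product form yields marginals and
independence, the density form yields rotation invariance. -/
theorem gauss_eq_pi : gauss ι = Measure.pi fun _ : ι => gaussLine := by
  symm
  refine Measure.pi_eq fun s hs => ?_
  let f : ι → ℝ → ℝ := fun i => (s i).indicator fun x => Real.exp (-Real.pi * x ^ 2)
  have hf0 : ∀ i x, 0 ≤ f i x := fun i x => indicator_nonneg (fun x _ => (Real.exp_pos _).le) x
  have hfi : ∀ i, Integrable (f i) := fun i => integrable_exp_neg_pi_mul_sq.indicator (hs i)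
  have hint : Integrable fun x : ι → ℝ => ∏ i, f i (x i) := Integrable.fintype_prod hfi
  have hline : ∀ i, gaussLine (s i) = ENNReal.ofReal (∫ x, f i x) := by
    intro i
    rw [gaussLine, withDensity_apply _ (hs i), ofReal_integral_eq_lintegral_ofReal (hfi i)
      (Filter.Eventually.of_forall (hf0 i)), ← lintegral_indicator (hs i)]
    refine lintegral_congr fun x => ?_
    by_cases hx : x ∈ s i <;> simp [f, hx]
  simp_rw [hline]
  rw [← ENNReal.ofReal_prod_of_nonneg fun i _ => integral_nonneg (hf0 i),
    ← integral_fintype_prod_volume_eq_prod, ofReal_integral_eq_lintegral_ofReal hint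
      (Filter.Eventually.of_forall fun x => Finset.prod_nonneg fun i _ => hf0 i _),
    gauss, withDensity_apply _ (MeasurableSet.univ_pi hs),
    ← lintegral_indicator (MeasurableSet.univ_pi hs)]
  refine lintegral_congr fun x => ?_
  by_cases hx : x ∈ univ.pi s
  · have hx' : ∀ i, x i ∈ s i := fun i => hx i (mem_univ i)
    rw [indicator_of_mem hx, gaussDensity, Finset.mul_sum, Real.exp_sum]
    simp [f, hx']
  · obtain ⟨i, hi⟩ : ∃ i, x i ∉ s i := by simpa [Set.mem_pi] using hx
    rw [indicator_of_notMem hx, Finset.prod_eq_zero (Finset.mem_univ i)]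
    · simp
    · simp [f, hi]

instance : IsProbabilityMeasure (gauss ι) := by rw [gauss_eq_pi]; infer_instance

theorem lintegral_gauss {F : (ι → ℝ) → ENNReal} (hF : Measurable F) :
    ∫⁻ x, F x ∂gauss ι = ∫⁻ x, gaussDensity x * F x := by
  rw [gauss, lintegral_withDensity_eq_lintegral_mul _ measurable_gaussDensity hF]
  rfl

/-- The coordinates are independent and identically distributed, so selecting distinct ones gives a
Gaussian again; this covers both relabelling and forgetting coordinates. -/
theorem measurePreserving_gauss_comp {f : κ → ι} (hf : Function.Injective f) :
    MeasurePreserving (fun x : ι → ℝ => x ∘ f) (gauss ι) (gauss κ) := by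
  have hm : Measurable fun x : ι → ℝ => x ∘ f :=
    measurable_pi_lambda _ fun k => measurable_pi_apply (f k)
  refine ⟨hm, ?_⟩
  rw [gauss_eq_pi, gauss_eq_pi]
  symm
  refine Measure.pi_eq fun s hs => ?_
  -- The preimage of a box is a box whose sides outside the range of `f` are the full line, of mass
  -- one.
  have hpre : (fun x : ι → ℝ => x ∘ f) ⁻¹' univ.pi s = univ.pi fun i => ⋂ k, ⋂ _ : f k = i, s k := by
    ext x
    simp only [mem_preimage, Set.mem_pi, mem_univ, true_implies, mem_iInter, Function.comp_apply]
    exact ⟨fun h i k hk => hk ▸ h k, fun h k => h _ k rfl⟩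
  rw [Measure.map_apply hm (MeasurableSet.univ_pi hs), hpre, Measure.pi_pi]
  refine (Fintype.prod_of_injective f hf _ _ (fun i hi => ?_) fun k => ?_).symm
  · have : (⋂ k, ⋂ _ : f k = i, s k) = univ := by
      refine eq_univ_of_forall fun x => ?_
      simp only [mem_iInter]
      exact fun k hk => absurd ⟨k, hk⟩ hi
    rw [this, measure_univ]
  · congr 1
    ext x
    simp only [mem_iInter]
    exact ⟨fun h k' hk => hf hk ▸ h, fun h => h k rfl⟩

theorem lintegral_gauss_sum {F : (ι ⊕ κ → ℝ) → ENNReal} (hF : Measurable F) :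
    ∫⁻ z, F z ∂gauss (ι ⊕ κ) = ∫⁻ x, ∫⁻ y, F (Sum.elim x y) ∂gauss κ ∂gauss ι := by
  have h := measurePreserving_sumPiEquivProdPi_symm (fun _ : ι ⊕ κ => gaussLine)
  rw [gauss_eq_pi, gauss_eq_pi, gauss_eq_pi, ← h.lintegral_comp hF]
  refine (lintegral_prod _ (hF.comp h.measurable).aemeasurable).trans ?_
  refine lintegral_congr fun x => lintegral_congr fun y => ?_
  congr 1

theorem inner_map_of_sq {L : (ι → ℝ) →ₗ[ℝ] ι → ℝ} (hL : ∀ x, ∑ i, L x i ^ 2 = ∑ i, x i ^ 2)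
    (x y : ι → ℝ) : ∑ i, L x i * L y i = ∑ i, x i * y i := by
  have h := hL (x + y)
  simp only [map_add, Pi.add_apply, add_sq, Finset.sum_add_distrib, hL] at h
  simp only [mul_assoc, ← Finset.mul_sum] at h
  linarith

theorem abs_det_of_sq {L : (ι → ℝ) →ₗ[ℝ] ι → ℝ} (hL : ∀ x, ∑ i, L x i ^ 2 = ∑ i, x i ^ 2) :
    |LinearMap.det L| = 1 := by
  classical
  have h : (LinearMap.toMatrix' L)ᵀ * LinearMap.toMatrix' L = 1 := by
    ext a b
    rw [Matrix.mul_apply]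
    simp only [Matrix.transpose_apply, LinearMap.toMatrix'_apply]
    rw [inner_map_of_sq hL]
    simp [Matrix.one_apply, Pi.single_apply, eq_comm]
  have h2 := congrArg Matrix.det h
  rw [Matrix.det_mul, Matrix.det_transpose, Matrix.det_one, LinearMap.det_toMatrix'] at h2
  rw [← sq_eq_sq₀ (abs_nonneg _) zero_le_one, sq_abs, one_pow, sq, h2]

/-- A linear isometry preserves Lebesgue measure, having determinant `±1`, and the density depends
on the norm only. -/
theorem measurePreserving_gauss_of_sq {L : (ι → ℝ) →ₗ[ℝ] ι → ℝ}
    (hL : ∀ x, ∑ i, L x i ^ 2 = ∑ i, x i ^ 2) : MeasurePreserving L (gauss ι) (gauss ι) := by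
  have hd := abs_det_of_sq hL
  have h0 : LinearMap.det L ≠ 0 := by
    intro h
    simp [h] at hd
  have hm : Measurable L := L.continuous_of_finiteDimensional.measurable
  have hv : MeasurePreserving L := by
    refine ⟨hm, ?_⟩
    rw [Real.map_linearMap_volume_pi_eq_smul_volume_pi h0, abs_inv, hd]
    simp
  refine ⟨hm, Measure.ext fun s hs => ?_⟩
  rw [Measure.map_apply hm hs, gauss, withDensity_apply _ hs, withDensity_apply _ (hm hs),
    ← hv.setLIntegral_comp_preimage hs measurable_gaussDensity]
  simp [gaussDensity, hL]

end Gaussian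

/-! ### Sphere volumes as Gaussian radial moments -/

section Radial

theorem sphereVol_eq (p : ℕ) : sphereVol p =
    p * (volume : Measure (EuclideanSpace ℝ (Fin p))).real (Metric.ball 0 1) := by
  rw [sphereVol, Measure.toSphere_apply_univ]
  simp [Measure.real]

theorem integral_norm_pow_mul_exp {p : ℕ} (hp : 0 < p) (m : ℕ) :
    ∫ x : EuclideanSpace ℝ (Fin p), ‖x‖ ^ m * Real.exp (-Real.pi * ‖x‖ ^ 2) =
      sphereVol p * ∫ r in Ioi (0 : ℝ), r ^ (p - 1) * (r ^ m * Real.exp (-Real.pi * r ^ 2)) := by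
  have : Nonempty (Fin p) := ⟨⟨0, hp⟩⟩
  rw [integral_fun_norm_addHaar volume fun r => r ^ m * Real.exp (-Real.pi * r ^ 2), sphereVol_eq]
  simp [mul_assoc]

/-- The total mass one of the Gaussian, in polar coordinates. It identifies every radial moment as
the reciprocal of a sphere volume, so no Gamma values are needed. -/
theorem sphereVol_mul_integral {p : ℕ} (hp : 0 < p) :
    sphereVol p * ∫ r in Ioi (0 : ℝ), r ^ (p - 1) * Real.exp (-Real.pi * r ^ 2) = 1 := by
  have h := integral_norm_pow_mul_exp hp 0
  simp only [pow_zero, one_mul] at h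
  rw [← h, GaussianFourier.integral_rexp_neg_mul_sq_norm Real.pi_pos, div_self Real.pi_ne_zero,
    Real.one_rpow]

theorem sphereVol_pos {p : ℕ} (hp : 0 < p) : 0 < sphereVol p :=
  lt_of_le_of_ne ENNReal.toReal_nonneg fun h => by
    have := sphereVol_mul_integral hp
    rw [← h, zero_mul] at this
    exact zero_ne_one this

/-- The factor `r ^ m` turns the radial integral of dimension `p` into the one of dimension `p + m`,
which is `1 / V_{p+m}`. -/
theorem lintegral_norm_pow_gauss {p : ℕ} (hp : 0 < p) (m : ℕ) :
    ∫⁻ x, ENNReal.ofReal (√(∑ i, x i ^ 2) ^ m) ∂gauss (Fin p) =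
      ENNReal.ofReal (sphereVol p / sphereVol (p + m)) := by
  have hnorm : ∀ x : EuclideanSpace ℝ (Fin p), ‖x‖ = √(∑ i, x i ^ 2) := by
    intro x; simp [EuclideanSpace.norm_eq]
  have hnorm2 : ∀ x : EuclideanSpace ℝ (Fin p), ‖x‖ ^ 2 = ∑ i, x i ^ 2 := by
    intro x; simp [EuclideanSpace.norm_sq_eq]
  have hval : ∫ x : EuclideanSpace ℝ (Fin p), ‖x‖ ^ m * Real.exp (-Real.pi * ‖x‖ ^ 2) =
      sphereVol p / sphereVol (p + m) := by
    have h1 := sphereVol_mul_integral (Nat.add_pos_left hp m)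
    have h2 : ∀ r : ℝ, r ^ (p - 1) * (r ^ m * Real.exp (-Real.pi * r ^ 2)) =
        r ^ (p + m - 1) * Real.exp (-Real.pi * r ^ 2) := by
      intro r
      rw [← mul_assoc, ← pow_add]
      congr 2
      omega
    rw [integral_norm_pow_mul_exp hp]
    simp_rw [h2]
    rw [eq_div_iff (sphereVol_pos (Nat.add_pos_left hp m)).ne', mul_assoc, mul_comm _ (sphereVol _),
      h1, mul_one]
  have hpos : 0 < sphereVol p / sphereVol (p + m) :=
    div_pos (sphereVol_pos hp) (sphereVol_pos (Nat.add_pos_left hp m))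
  have hint : Integrable fun x : EuclideanSpace ℝ (Fin p) =>
      ‖x‖ ^ m * Real.exp (-Real.pi * ‖x‖ ^ 2) := by
    -- A non-integrable function would have Bochner integral zero, but the value found is positive.
    by_contra h
    rw [integral_undef h] at hval
    exact hpos.ne hval
  rw [lintegral_gauss (by fun_prop), ← hval, ofReal_integral_eq_lintegral_ofReal hint
    (Filter.Eventually.of_forall fun x => by positivity),
    ← (PiLp.volume_preserving_ofLp (Fin p)).lintegral_comp (by
      have := measurable_gaussDensity (ι := Fin p)
      fun_prop)]
  refine lintegral_congr fun x => ?_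
  rw [gaussDensity, ← ENNReal.ofReal_mul (Real.exp_pos _).le, mul_comm, hnorm, ← hnorm, hnorm2,
    hnorm]

end Radial

/-! ### Determinants of Gaussian matrices and their symmetry -/

section

/-- The power `|x|^m`, with the value zero at `x = 0` even for `m = 0`. -/
def detPow (m : ℕ) (x : ℝ) : ENNReal := if x = 0 then 0 else ENNReal.ofReal (|x| ^ m)

theorem detPow_zero (m : ℕ) : detPow m 0 = 0 := if_pos rfl

theorem detPow_of_ne {m : ℕ} {x : ℝ} (hx : x ≠ 0) : detPow m x = ENNReal.ofReal (|x| ^ m) :=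
  if_neg hx

theorem detPow_mul (m : ℕ) (x y : ℝ) : detPow m (x * y) = detPow m x * detPow m y := by
  by_cases hx : x = 0
  · simp [hx, detPow_zero]
  by_cases hy : y = 0
  · simp [hy, detPow_zero]
  rw [detPow_of_ne hx, detPow_of_ne hy, detPow_of_ne (mul_ne_zero hx hy), abs_mul, mul_pow,
    ENNReal.ofReal_mul (by positivity)]

theorem detPow_eq_one {m : ℕ} {x : ℝ} (hx : |x| = 1) : detPow m x = 1 := by
  have : x ≠ 0 := by rintro rfl; simp at hx
  simp [detPow_of_ne this, hx]

theorem detPow_neg (m : ℕ) (x : ℝ) : detPow m (-x) = detPow m x := by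
  simp [detPow]

theorem measurable_detPow (m : ℕ) : Measurable (detPow m) :=
  Measurable.ite (measurableSet_singleton 0) measurable_const (by fun_prop)

/-- The square matrix with given entries. -/
def toMat {ι : Type*} (z : ι × ι → ℝ) : Matrix ι ι ℝ := Matrix.of fun i j => z (i, j)

section

variable {ι κ : Type*} [Fintype ι] [Fintype κ] [DecidableEq ι] [DecidableEq κ]

theorem continuous_det_toMat : Continuous fun z : ι × ι → ℝ => (toMat z).det :=
  Continuous.matrix_det (by unfold toMat; fun_prop)

theorem measurable_det_toMat : Measurable fun z : ι × ι → ℝ => (toMat z).det :=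
  continuous_det_toMat.measurable

/-- The law of the determinant of a Gaussian random matrix. -/
def detLaw (ι : Type*) [Fintype ι] [DecidableEq ι] : Measure ℝ :=
  (gauss (ι × ι)).map fun z => (toMat z).det

instance : IsProbabilityMeasure (detLaw ι) :=
  Measure.isProbabilityMeasure_map measurable_det_toMat.aemeasurable

theorem detLaw_congr (e : ι ≃ κ) : detLaw ι = detLaw κ := by
  have h := measurePreserving_gauss_comp (f := Prod.map e e)
    (e.injective.prodMap e.injective)
  rw [detLaw, ← h.map_eq, Measure.map_map measurable_det_toMat h.measurable, detLaw]
  congr 1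
  ext z
  exact Matrix.det_submatrix_equiv_self e (toMat z)

/-- Negating one row is an isometry of the Gaussian and changes the sign of the determinant. An
empty matrix has no row to negate: its determinant is 1. -/
theorem measurePreserving_neg_detLaw [Nonempty ι] :
    MeasurePreserving (fun x : ℝ => -x) (detLaw ι) (detLaw ι) := by
  obtain ⟨i₀⟩ := ‹Nonempty ι›
  let s : ι → ℝ := fun i => if i = i₀ then -1 else 1
  have hs : ∀ i, s i ^ 2 = 1 := fun i => by by_cases h : i = i₀ <;> simp [s, h]
  let L : (ι × ι → ℝ) →ₗ[ℝ] ι × ι → ℝ :=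
    { toFun := fun z p => s p.1 * z p
      map_add' := fun x y => by ext p; simp [mul_add]
      map_smul' := fun a x => by ext p; simp [mul_left_comm] }
  have hL : MeasurePreserving L (gauss (ι × ι)) (gauss (ι × ι)) :=
    measurePreserving_gauss_of_sq fun x => by
      change ∑ p, (s p.1 * x p) ^ 2 = _
      simp [mul_pow, hs]
  refine ⟨measurable_neg, ?_⟩
  rw [detLaw, Measure.map_map measurable_neg measurable_det_toMat]
  conv_rhs => rw [← hL.map_eq, Measure.map_map measurable_det_toMat hL.measurable]
  congr 1
  ext z
  have : toMat (L z) = Matrix.of fun i j => s i * toMat z i j := rfl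
  rw [Function.comp_apply, Function.comp_apply, this, Matrix.det_mul_column]
  simp [s]

end

/-! ### Moments of the determinant by induction on the size -/

section Recursion

/-- The matrix with first row `v` and the other rows given by `y`. -/
def consRow {l : ℕ} (v : Fin (l + 1) → ℝ) (y : Fin l × Fin (l + 1) → ℝ) :
    Matrix (Fin (l + 1)) (Fin (l + 1)) ℝ :=
  Matrix.of (Fin.cons v fun i j => y (i, j))

theorem lintegral_gauss_consRow {l : ℕ} {F : Matrix (Fin (l + 1)) (Fin (l + 1)) ℝ → ENNReal}
    (hF : Measurable fun z => F (toMat z)) :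
    ∫⁻ z, F (toMat z) ∂gauss (Fin (l + 1) × Fin (l + 1)) =
      ∫⁻ v, ∫⁻ y, F (consRow v y) ∂gauss (Fin l × Fin (l + 1)) ∂gauss (Fin (l + 1)) := by
  let f : Fin (l + 1) × Fin (l + 1) → Fin (l + 1) ⊕ Fin l × Fin (l + 1) :=
    fun p => Fin.cases (motive := fun _ => Fin (l + 1) ⊕ Fin l × Fin (l + 1)) (Sum.inl p.2)
      (fun i => Sum.inr (i, p.2)) p.1
  have hf : Function.Injective f := by
    rintro ⟨i, j⟩ ⟨i', j'⟩ h
    induction i using Fin.cases <;> induction i' using Fin.cases <;> simp_all [f]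
  have h := measurePreserving_gauss_comp hf
  rw [← h.lintegral_comp hF]
  refine (lintegral_gauss_sum (hF.comp h.measurable)).trans ?_
  refine lintegral_congr fun v => lintegral_congr fun y => ?_
  refine congrArg F ?_
  ext i j
  induction i using Fin.cases <;> simp [toMat, consRow, f]

theorem det_consRow_single {l : ℕ} (r : ℝ) (y : Fin l × Fin (l + 1) → ℝ) :
    (consRow (Pi.single 0 r) y).det =
      r * (toMat (y ∘ Prod.map id Fin.succ)).det := by
  rw [Matrix.det_succ_row_zero, Fin.sum_univ_succ]
  simp [consRow]
  left
  congr 1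

theorem exists_orthogonal_vecMul {l : ℕ} {v : Fin (l + 1) → ℝ} (hv : v ≠ 0) :
    ∃ O : Matrix (Fin (l + 1)) (Fin (l + 1)) ℝ, O * Oᵀ = 1 ∧
      v ᵥ* O = Pi.single 0 √(∑ i, v i ^ 2) := by
  let w : EuclideanSpace ℝ (Fin (l + 1)) := WithLp.toLp 2 v
  have hw : w ≠ 0 := fun h => hv (by simpa [w] using congrArg WithLp.ofLp h)
  have hw' : ‖w‖ ≠ 0 := norm_ne_zero_iff.2 hw
  -- The constant family `v / |v|` is orthonormal on the index set `{0}`; the extension is a basis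
  -- with `b 0 = v / |v|`, used as the columns of `O`.
  obtain ⟨b, hb⟩ := Orthonormal.exists_orthonormalBasis_extension_of_card_eq (𝕜 := ℝ)
    (E := EuclideanSpace ℝ (Fin (l + 1))) (ι := Fin (l + 1)) (by simp)
    (v := fun _ => ‖w‖⁻¹ • w) (s := {0}) (by
      rw [orthonormal_iff_ite]
      rintro ⟨i, rfl⟩ ⟨j, rfl⟩
      simpa using Or.inl (norm_smul_inv_norm (𝕜 := ℝ) hw))
  have hb0 : w = ‖w‖ • b 0 := by rw [hb 0 rfl, smul_smul, mul_inv_cancel₀ hw', one_smul]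
  have hO : (Matrix.of fun i j => b j i)ᵀ * (Matrix.of fun i j => b j i) =
      (1 : Matrix (Fin (l + 1)) (Fin (l + 1)) ℝ) := by
    ext i j
    have := orthonormal_iff_ite.1 b.orthonormal j i
    rw [PiLp.inner_apply] at this
    simpa [Matrix.mul_apply, Matrix.one_apply, eq_comm] using this
  refine ⟨Matrix.of fun i j => b j i, mul_eq_one_comm.1 hO, ?_⟩
  ext j
  have h1 : (v ᵥ* Matrix.of fun i j => b j i) j = inner ℝ (b j) w := by
    rw [PiLp.inner_apply]
    simp [Matrix.vecMul, dotProduct, w]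
  have h2 : ‖w‖ = √(∑ i, v i ^ 2) := by simp [EuclideanSpace.norm_eq, w]
  rw [h1, hb0, inner_smul_right, orthonormal_iff_ite.1 b.orthonormal j 0, h2]
  by_cases hj : j = 0
  · subst hj; simp
  · simp [hj]

theorem sum_sq_vecMul {ι : Type*} [Fintype ι] [DecidableEq ι] {O : Matrix ι ι ℝ} (hO : O * Oᵀ = 1)
    (x : ι → ℝ) : ∑ j, (x ᵥ* O) j ^ 2 = ∑ j, x j ^ 2 := by
  have h : (x ᵥ* O) ⬝ᵥ (x ᵥ* O) = x ⬝ᵥ x := by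
    rw [← Matrix.dotProduct_mulVec, ← Matrix.vecMul_transpose, Matrix.vecMul_vecMul, hO,
      Matrix.vecMul_one]
  simpa [dotProduct, sq] using h

/-- Right multiplication by a square matrix, on matrices with arbitrarily many rows. -/
def mulRows {ι κ : Type*} [Fintype κ] (O : Matrix κ κ ℝ) : (ι × κ → ℝ) →ₗ[ℝ] ι × κ → ℝ where
  toFun y p := ∑ k, y (p.1, k) * O k p.2
  map_add' x y := by ext p; simp [add_mul, Finset.sum_add_distrib]
  map_smul' a x := by ext p; simp [mul_assoc, Finset.mul_sum]

theorem sum_sq_mulRows {ι κ : Type*} [Fintype ι] [Fintype κ] [DecidableEq κ] {O : Matrix κ κ ℝ}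
    (hO : O * Oᵀ = 1) (x : ι × κ → ℝ) : ∑ p, mulRows O x p ^ 2 = ∑ p, x p ^ 2 := by
  rw [Fintype.sum_prod_type, Fintype.sum_prod_type]
  exact Finset.sum_congr rfl fun i _ => sum_sq_vecMul hO fun k => x (i, k)

/-- For fixed first row `v`, a rotation on the right takes `v` to `|v| e₀`. It changes neither
`|det|` nor the law of the other rows, and expansion along the first row leaves `|v|` times the
determinant of a smaller Gaussian matrix. -/
theorem lintegral_detPow_consRow {l : ℕ} (m : ℕ) (v : Fin (l + 1) → ℝ) :
    ∫⁻ y, detPow m (consRow v y).det ∂gauss (Fin l × Fin (l + 1)) =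
      detPow m √(∑ i, v i ^ 2) * ∫⁻ x, detPow m x ∂detLaw (Fin l) := by
  by_cases hv : v = 0
  -- Both sides vanish, for `m = 0` as well, because `detPow` is zero at zero.
  · subst hv
    have : ∀ y : Fin l × Fin (l + 1) → ℝ, (consRow 0 y).det = 0 := fun y =>
      Matrix.det_eq_zero_of_row_eq_zero 0 fun j => by simp [consRow]
    simp [this, detPow_zero]
  obtain ⟨O, hO, hvO⟩ := exists_orthogonal_vecMul hv
  have hL := measurePreserving_gauss_of_sq (sum_sq_mulRows (ι := Fin l) hO)
  have hdet : |O.det| = 1 := by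
    have := congrArg Matrix.det hO
    rw [Matrix.det_mul, Matrix.det_transpose, Matrix.det_one] at this
    rw [← sq_eq_sq₀ (abs_nonneg _) zero_le_one, sq_abs, one_pow, sq, this]
  have hmul : ∀ y, consRow v y * O = consRow (Pi.single 0 √(∑ i, v i ^ 2)) (mulRows O y) := by
    intro y
    ext i j
    induction i using Fin.cases with
    | zero =>
      have := congrFun hvO j
      simpa [Matrix.mul_apply, consRow, Matrix.vecMul, dotProduct] using this
    | succ i => simp [Matrix.mul_apply, consRow, mulRows]
  have hpt : ∀ y, detPow m (consRow v y).det = detPow m √(∑ i, v i ^ 2) *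
      detPow m (toMat (mulRows O y ∘ Prod.map id Fin.succ)).det := by
    intro y
    rw [← detPow_mul, ← det_consRow_single, ← hmul, Matrix.det_mul, detPow_mul,
      detPow_eq_one hdet, mul_one]
  have hc := measurePreserving_gauss_comp (f := Prod.map (id : Fin l → Fin l) (Fin.succ (n := l)))
    (Function.injective_id.prodMap (Fin.succ_injective _))
  have hm := (measurable_detPow m).comp (measurable_det_toMat (ι := Fin l))
  simp_rw [hpt]
  refine (lintegral_const_mul _ (hm.comp (hc.measurable.comp hL.measurable))).trans ?_
  rw [detLaw, lintegral_map (measurable_detPow m) measurable_det_toMat]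
  congr 1
  refine Eq.symm ?_
  refine (hc.lintegral_comp hm).symm.trans ?_
  exact (hL.lintegral_comp (hm.comp hc.measurable)).symm

theorem lintegral_detPow_sqrt {p : ℕ} (hp : 0 < p) (m : ℕ) :
    ∫⁻ v, detPow m √(∑ i, v i ^ 2) ∂gauss (Fin p) =
      ENNReal.ofReal (sphereVol p / sphereVol (p + m)) := by
  rw [← lintegral_norm_pow_gauss hp m]
  refine lintegral_congr_ae ?_
  have hac : gauss (Fin p) ≪ volume := withDensity_absolutelyContinuous _ _
  have : Nonempty (Fin p) := ⟨⟨0, hp⟩⟩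
  have h0 : ∀ᵐ v ∂gauss (Fin p), v ≠ 0 := hac.ae_le (Measure.ae_ne volume 0)
  filter_upwards [h0] with v hv
  have hs : √(∑ i, v i ^ 2) ≠ 0 := by
    intro h
    rw [Real.sqrt_eq_zero (Finset.sum_nonneg fun i _ => sq_nonneg _),
      Finset.sum_eq_zero_iff_of_nonneg fun i _ => sq_nonneg _] at h
    exact hv (funext fun i => by simpa using h i (Finset.mem_univ i))
  rw [detPow_of_ne hs, abs_of_nonneg (Real.sqrt_nonneg _)]

theorem lintegral_detPow_detLaw (l m : ℕ) : ∫⁻ x, detPow m x ∂detLaw (Fin l) =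
    ENNReal.ofReal (∏ i ∈ Finset.Icc 1 l, sphereVol i / sphereVol (i + m)) := by
  induction l with
  | zero =>
    rw [detLaw, lintegral_map (measurable_detPow m) measurable_det_toMat]
    simp [detPow_of_ne]
  | succ l ih =>
    have hm := (measurable_detPow m).comp (measurable_det_toMat (ι := Fin (l + 1)))
    have hpos : ∀ i ∈ Finset.Icc 1 l, 0 ≤ sphereVol i / sphereVol (i + m) := fun i hi =>
      (div_pos (sphereVol_pos (Finset.mem_Icc.1 hi).1)
        (sphereVol_pos (Nat.add_pos_left (Finset.mem_Icc.1 hi).1 m))).le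
    rw [detLaw, lintegral_map (measurable_detPow m) measurable_det_toMat,
      lintegral_gauss_consRow (F := fun A => detPow m A.det) hm]
    simp_rw [lintegral_detPow_consRow]
    rw [lintegral_mul_const _ (show Measurable fun v : Fin (l + 1) → ℝ => detPow m √(∑ i, v i ^ 2)
        from (measurable_detPow m).comp (by fun_prop)),
      lintegral_detPow_sqrt l.succ_pos, ih, Finset.prod_Icc_succ_top (by omega),
      ENNReal.ofReal_mul (Finset.prod_nonneg hpos), mul_comm]

end Recursion

/-! ### Each sign condition halves the integral -/

section Signs

variable {κ : Type*} [Fintype κ] [DecidableEq κ]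

-- Induction on the set of sign conditions. To drop the one for `α`, negate a single `x j₀` with `j₀
-- ∈ α`: as the parts are disjoint, this reverses only the sign for `α`, and it preserves the
-- measure and the even weights.
open Classical in
theorem two_pow_mul_lintegral_signs (P : Finpartition (Finset.univ : Finset κ))
    (ρ : κ → Measure ℝ) [∀ j, IsProbabilityMeasure (ρ j)]
    (hρ : ∀ j, MeasurePreserving (fun x : ℝ => -x) (ρ j) (ρ j)) (m : κ → ℕ)
    (S : Finset (Finset κ)) (hS : S ⊆ P.parts) :
    2 ^ S.card * ∫⁻ x, (if ∀ α ∈ S, 0 < ∏ j ∈ α, x j then ∏ j, detPow (m j) (x j) else 0)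
      ∂Measure.pi ρ = ∏ j, ∫⁻ x, detPow (m j) x ∂ρ j := by
  have hmeas : ∀ S : Finset (Finset κ), Measurable fun x : κ → ℝ =>
      if ∀ α ∈ S, 0 < ∏ j ∈ α, x j then ∏ j, detPow (m j) (x j) else 0 := by
    intro S
    refine Measurable.ite ?_ (Finset.measurable_prod _ fun j _ =>
      (measurable_detPow _).comp (measurable_pi_apply j)) measurable_const
    simp only [Set.ofPred_forall]
    refine Finset.measurableSet_biInter _ fun α _ => ?_
    exact measurableSet_lt measurable_const (by fun_prop)
  induction S using Finset.induction_on with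
  | empty =>
    simp only [Finset.card_empty, pow_zero, one_mul, Finset.notMem_empty, false_implies,
      implies_true, if_true]
    have hind := ProbabilityTheory.iIndepFun_pi (μ := ρ) (X := fun j => detPow (m j))
      fun j => (measurable_detPow _).aemeasurable
    rw [ProbabilityTheory.lintegral_prod_eq_prod_lintegral_of_indepFun _ _ hind fun j =>
      (measurable_detPow _).comp (measurable_pi_apply j)]
    refine Finset.prod_congr rfl fun j _ => ?_
    exact (measurePreserving_eval ρ j).lintegral_comp (measurable_detPow _)
  | insert α S hα ih =>
    obtain ⟨hαP, hSP⟩ := Finset.insert_subset_iff.1 hS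
    obtain ⟨j₀, hj₀⟩ := P.nonempty_of_mem_parts hαP
    let s : κ → ℝ := fun j => if j = j₀ then -1 else 1
    have hflip : MeasurePreserving (fun (x : κ → ℝ) j => s j * x j) (Measure.pi ρ)
        (Measure.pi ρ) := by
      refine measurePreserving_pi ρ ρ fun j => ?_
      by_cases h : j = j₀
      · subst h
        convert hρ j using 2 with x
        simp [s]
      · convert MeasurePreserving.id (ρ j) using 2
        ext x
        simp [s, h]
    have hprod : ∀ β ∈ P.parts, ∀ x : κ → ℝ, ∏ j ∈ β, (s j * x j) =
        (if β = α then -1 else 1) * ∏ j ∈ β, x j := by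
      intro β hβ x
      rw [Finset.prod_mul_distrib]
      congr 1
      by_cases h : β = α
      · simp [s, h, hj₀]
      · have : j₀ ∉ β := fun hj => h (P.eq_of_mem_parts hβ hαP hj hj₀)
        simp [s, h, this]
    rw [← ih hSP, Finset.card_insert_of_notMem hα, pow_succ, mul_assoc]
    congr 1
    rw [two_mul]
    -- Only the second of the two equal copies is flipped, so that the copies carry complementary
    -- signs for `α`.
    conv_lhs =>
      enter [2]
      rw [← hflip.lintegral_comp (hmeas _)]
    rw [← lintegral_add_left (hmeas _)]
    refine lintegral_congr fun x => ?_
    have hH : ∏ j, detPow (m j) (s j * x j) = ∏ j, detPow (m j) (x j) := by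
      refine Finset.prod_congr rfl fun j _ => ?_
      by_cases h : j = j₀ <;> simp [s, h, detPow_neg]
    have hS' : (∀ β ∈ S, 0 < ∏ j ∈ β, (s j * x j)) ↔ ∀ β ∈ S, 0 < ∏ j ∈ β, x j := by
      refine forall₂_congr fun β hβ => ?_
      rw [hprod β (hSP hβ), if_neg (ne_of_mem_of_not_mem hβ hα), one_mul]
    simp only [Finset.forall_mem_insert, hS', hH, hprod α hαP, if_true]
    by_cases hx : ∀ β ∈ S, 0 < ∏ j ∈ β, x j
    · rcases lt_trichotomy (∏ j ∈ α, x j) 0 with h | h | h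
      · simp [h, not_lt.2 h.le]
      -- Neither copy counts a vanishing product over `α`, and there the weight is zero by the
      -- convention for `detPow`.
      · obtain ⟨j, -, hj⟩ := Finset.prod_eq_zero_iff.1 h
        have : ∏ j, detPow (m j) (x j) = 0 :=
          Finset.prod_eq_zero (Finset.mem_univ j) (by rw [hj, detPow_zero])
        simp [this]
      · simp [h, not_lt.2 h.le]
    · simp [hx]

end Signs

/-! ### Independence of the diagonal block determinants -/

section Blocks

theorem measurePreserving_gauss_curry {κ : Type*} [Fintype κ] {β : κ → Type*}
    [∀ j, Fintype (β j)] :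
    MeasurePreserving (fun (z : (Σ j, β j) → ℝ) j p => z ⟨j, p⟩) (gauss (Σ j, β j))
      (Measure.pi fun j => gauss (β j)) := by
  refine ⟨by fun_prop, ?_⟩
  have h := Measure.infinitePi_map_piCurry (fun (j : κ) (_ : β j) => gaussLine)
  simp only [Measure.infinitePi_eq_pi] at h
  simp only [gauss_eq_pi]
  exact h

variable {ι κ : Type*} [Fintype ι] [Fintype κ] [DecidableEq ι] [DecidableEq κ]

/-- The determinant of the `j`-th diagonal block, for the blocks that are the fibres of `b`. -/
def blockDet (b : ι → κ) (A : Matrix ι ι ℝ) (j : κ) : ℝ :=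
  (A.submatrix (Subtype.val : {i // b i = j} → ι) Subtype.val).det

/-- The diagonal blocks use disjoint sets of entries, hence their determinants are independent. -/
theorem measurePreserving_blockDet (b : ι → κ) :
    MeasurePreserving (fun z : ι × ι → ℝ => blockDet b (toMat z)) (gauss (ι × ι))
      (Measure.pi fun j => detLaw {i // b i = j}) := by
  let f : (Σ j, {i // b i = j} × {i // b i = j}) → ι × ι := fun q => (q.2.1, q.2.2)
  have hf : Function.Injective f := by
    rintro ⟨j, ⟨p, hp⟩, ⟨q, hq⟩⟩ ⟨j', ⟨p', hp'⟩, ⟨q', hq'⟩⟩ h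
    simp only [f, Prod.mk.injEq] at h
    obtain ⟨rfl, rfl⟩ := h
    subst hp hp'
    rfl
  exact (measurePreserving_pi _ _ fun j => ⟨measurable_det_toMat, rfl⟩).comp
    (measurePreserving_gauss_curry.comp (measurePreserving_gauss_comp hf))

open Classical in
/-- The total mass that the change of variables attaches to the block upper triangular factor. -/
def triangularMass (b : ι → κ) (P : Finpartition (Finset.univ : Finset κ)) (m : κ → ℕ) : ENNReal :=
  ∫⁻ z, (if ∀ α ∈ P.parts, 0 < ∏ j ∈ α, blockDet b (toMat z) j then
    ∏ j, detPow (m j) (blockDet b (toMat z) j) else 0) ∂gauss (ι × ι)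

theorem two_pow_mul_triangularMass {b : ι → κ} (hb : Function.Surjective b)
    (P : Finpartition (Finset.univ : Finset κ)) (m : κ → ℕ) :
    2 ^ P.parts.card * triangularMass b P m =
      ∏ j, ∫⁻ x, detPow (m j) x ∂detLaw {i // b i = j} := by
  classical
  have hne : ∀ j, Nonempty {i // b i = j} := fun j => (hb j).elim fun i hi => ⟨⟨i, hi⟩⟩
  rw [← two_pow_mul_lintegral_signs P _ (fun j => measurePreserving_neg_detLaw) m P.parts
    subset_rfl, ← (measurePreserving_blockDet b).lintegral_comp, triangularMass]
  · refine Measurable.ite ?_ (Finset.measurable_prod _ fun j _ =>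
      (measurable_detPow _).comp (measurable_pi_apply j)) measurable_const
    simp only [Set.ofPred_forall]
    refine Finset.measurableSet_biInter _ fun α _ => ?_
    exact measurableSet_lt measurable_const (by fun_prop)

theorem gauss_det_pos {n : ℕ} (hn : 0 < n) :
    gauss (Fin n × Fin n) {z | 0 < (toMat z).det} = 2⁻¹ := by
  have : Nonempty (Fin n) := ⟨⟨0, hn⟩⟩
  have hmp : MeasurePreserving (fun z : Fin n × Fin n → ℝ => (toMat z).det) (gauss _)
      (detLaw (Fin n)) := ⟨measurable_det_toMat, rfl⟩
  have h0 : ∫⁻ x, detPow 0 x ∂detLaw (Fin n) = 1 := by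
    rw [lintegral_detPow_detLaw, Finset.prod_eq_one fun i hi => ?_, ENNReal.ofReal_one]
    rw [add_zero, div_self (sphereVol_pos (Finset.mem_Icc.1 hi).1).ne']
  -- `detPow 0` is the indicator of the nonzero reals, so the moment of order zero says that a
  -- Gaussian matrix is almost surely invertible; by symmetry each sign has probability one half.
  have h1 : detPow 0 = (Ioi (0 : ℝ)).indicator 1 + (Iio (0 : ℝ)).indicator 1 := by
    ext x
    rcases lt_trichotomy x 0 with h | rfl | h
    · simp [detPow, h.ne, h, not_lt.2 h.le]
    · simp [detPow]
    · simp [detPow, h.ne', h, not_lt.2 h.le]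
  rw [h1] at h0
  simp only [Pi.add_apply] at h0
  rw [lintegral_add_left (measurable_one.indicator measurableSet_Ioi),
    lintegral_indicator_one measurableSet_Ioi, lintegral_indicator_one measurableSet_Iio,
    ← (measurePreserving_neg_detLaw (ι := Fin n)).measure_preimage
      measurableSet_Iio.nullMeasurableSet] at h0
  have h2 : (fun x : ℝ => -x) ⁻¹' Iio 0 = Ioi 0 := by ext; simp
  rw [h2, ← two_mul] at h0
  rw [← ENNReal.eq_inv_of_mul_eq_one_left ((mul_comm _ _).trans h0)]
  exact (hmp.measure_preimage measurableSet_Ioi.nullMeasurableSet)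

end Blocks

end

section

variable {n : ℕ} (c : Composition n) (P : Finpartition (Finset.univ : Finset (Fin c.length)))

/-! ### Factorization into a rotation and a block triangular matrix -/

section Algebra

theorem monotone_index : Monotone c.index := by
  intro i j hij
  by_contra h
  have h1 := c.lt_sizeUpTo_index_succ j
  have h2 := c.sizeUpTo_index_le i
  have h3 := c.monotone_sizeUpTo (show (c.index j).succ ≤ (c.index i : ℕ) by
    simpa [Nat.succ_le_iff] using not_le.1 h)
  have h4 : (i : ℕ) ≤ j := hij
  simp only [Fin.val_succ] at h1 h3
  omega

/-- The block upper triangular matrices whose parts on the members of `P` have positive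
determinant. -/
def Tri : Set (Matrix (Fin n) (Fin n) ℝ) :=
  {T | T.BlockTriangular c.index ∧ ∀ α ∈ P.parts, 0 < (blockPart c α T).det}

variable {c P}

theorem det_blockPart {T : Matrix (Fin n) (Fin n) ℝ} (hT : T.BlockTriangular c.index)
    (α : Finset (Fin c.length)) :
    (blockPart c α T).det = ∏ j ∈ α, blockDet c.index T j := by
  have h : (blockPart c α T).BlockTriangular fun i => c.index i.1 := hT.submatrix
  rw [h.det_fintype, ← Finset.prod_subset (Finset.subset_univ α)]
  · refine Finset.prod_congr rfl fun j hj => ?_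
    let e : {i : {i : Fin n // c.index i ∈ α} // c.index i.1 = j} ≃ {i : Fin n // c.index i = j} :=
      { toFun := fun i => ⟨i.1.1, i.2⟩
        invFun := fun i => ⟨⟨i.1, by rw [i.2]; exact hj⟩, i.2⟩
        left_inv := fun _ => rfl
        right_inv := fun _ => rfl }
    exact Matrix.det_submatrix_equiv_self e
      (T.submatrix (Subtype.val : {i : Fin n // c.index i = j} → Fin n) Subtype.val)
  · intro j _ hj
    have : IsEmpty {i : {i : Fin n // c.index i ∈ α} // c.index i.1 = j} :=
      ⟨fun i => hj (i.2 ▸ i.1.2)⟩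
    exact Matrix.det_isEmpty

theorem det_eq_prod_blockDet {T : Matrix (Fin n) (Fin n) ℝ} (hT : T.BlockTriangular c.index) :
    T.det = ∏ j, blockDet c.index T j :=
  hT.det_fintype

theorem det_pos_of_mem_Tri {T : Matrix (Fin n) (Fin n) ℝ} (hT : T ∈ Tri c P) : 0 < T.det := by
  rw [det_eq_prod_blockDet hT.1, ← P.biUnion_parts, Finset.prod_biUnion P.disjoint]
  refine Finset.prod_pos fun α hα => ?_
  rw [id, ← det_blockPart hT.1]
  exact hT.2 α hα

theorem IsBlockDiagonal.blockTriangular {A : Matrix (Fin n) (Fin n) ℝ}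
    (hA : IsBlockDiagonal c A) : A.BlockTriangular c.index := fun i j h => hA i j h.ne'

theorem SG_mul_mem_Tri {H : SO n} (hH : H ∈ SG c P) {T : Matrix (Fin n) (Fin n) ℝ}
    (hT : T ∈ Tri c P) : H.1 * T ∈ Tri c P := by
  refine ⟨hH.1.blockTriangular.mul hT.1, fun α hα => ?_⟩
  rw [blockPart_mul c α hH.1, Matrix.det_mul, hH.2 α hα, one_mul]
  exact hT.2 α hα

theorem one_mem_Tri : (1 : Matrix (Fin n) (Fin n) ℝ) ∈ Tri c P :=
  ⟨Matrix.blockTriangular_one, fun α _ => by simp [blockPart_one]⟩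

theorem transpose_mul_SO (Q : SO n) : Q.1ᵀ * Q.1 = 1 :=
  congrArg Subtype.val (inv_mul_cancel Q)

theorem mul_transpose_SO (Q : SO n) : Q.1 * Q.1ᵀ = 1 :=
  congrArg Subtype.val (mul_inv_cancel Q)

theorem det_SO (Q : SO n) : Q.1.det = 1 := (Matrix.mem_specialOrthogonalGroup_iff.1 Q.2).2

theorem proj_eq_proj {Q Q' : SO n} : proj c P Q = proj c P Q' ↔ Q⁻¹ * Q' ∈ SG c P :=
  QuotientGroup.eq

/-- `H = T T'⁻¹` and `Hᵀ = T' T⁻¹` are both block upper triangular, so `H` is block diagonal. Its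
parts are orthogonal, with determinant `±1`, and positivity for `T` and `T'` selects `+1`. -/
theorem mem_SG_of_mul_mem_Tri {H : SO n} {T T' : Matrix (Fin n) (Fin n) ℝ} (hT : T ∈ Tri c P)
    (hT' : T' ∈ Tri c P) (h : H.1 * T' = T) : H ∈ SG c P := by
  have : Invertible T := Matrix.invertibleOfIsUnitDet _ (det_pos_of_mem_Tri hT).ne'.isUnit
  have : Invertible T' := Matrix.invertibleOfIsUnitDet _ (det_pos_of_mem_Tri hT').ne'.isUnit
  have h1 : H.1 = T * T'⁻¹ := by rw [← h, Matrix.mul_inv_cancel_right_of_invertible]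
  have h2 : H.1ᵀ = T' * T⁻¹ := by
    have h3 : H.1ᵀ * T = T' := by rw [← h, ← mul_assoc, transpose_mul_SO, one_mul]
    rw [← h3, Matrix.mul_inv_cancel_right_of_invertible]
  have hd : IsBlockDiagonal c H.1 := by
    intro i j hij
    rcases lt_or_gt_of_ne hij with hlt | hlt
    · rw [← Matrix.transpose_apply H.1, h2]
      exact hT'.1.mul (Matrix.blockTriangular_inv_of_blockTriangular hT.1) hlt
    · rw [h1]
      exact hT.1.mul (Matrix.blockTriangular_inv_of_blockTriangular hT'.1) hlt
  refine ⟨hd, fun α hα => ?_⟩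
  have h3 : (blockPart c α H.1).det * (blockPart c α T').det = (blockPart c α T).det := by
    rw [← Matrix.det_mul, ← blockPart_mul c α hd, h]
  have h4 : (blockPart c α H.1).det * (blockPart c α H.1).det = 1 := by
    conv_lhs => enter [2]; rw [← Matrix.det_transpose, ← blockPart_transpose]
    rw [← Matrix.det_mul, ← blockPart_mul c α hd, mul_transpose_SO, blockPart_one, Matrix.det_one]
  have h5 : 0 < (blockPart c α H.1).det :=
    pos_of_mul_pos_left (h3 ▸ hT.2 α hα) (hT'.2 α hα).le
  nlinarith

theorem proj_eq_of_mul_eq {Q Q' : SO n} {T T' : Matrix (Fin n) (Fin n) ℝ} (hT : T ∈ Tri c P)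
    (hT' : T' ∈ Tri c P) (h : Q.1 * T = Q'.1 * T') : proj c P Q = proj c P Q' := by
  rw [proj_eq_proj]
  refine mem_SG_of_mul_mem_Tri hT hT' ?_
  change Q.1ᵀ * Q'.1 * T' = T
  rw [mul_assoc, ← h, ← mul_assoc, transpose_mul_SO, one_mul]

theorem mem_Tri_of_isUpperTriangular {T : Matrix (Fin n) (Fin n) ℝ}
    (hT : ∀ i j, j < i → T i j = 0) (hpos : ∀ i, 0 < T i i) : T ∈ Tri c P := by
  refine ⟨fun i j h => hT i j ((monotone_index c).reflect_lt h), fun α _ => ?_⟩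
  have h : (blockPart c α T).IsUpperTriangular := fun i j hij => hT _ _ hij
  rw [Matrix.det_of_isUpperTriangular h]
  exact Finset.prod_pos fun i _ => hpos _

/-- The QR decomposition. An upper triangular factor with positive diagonal lies in `Tri c P`
whatever `c` and `P` are. -/
theorem exists_SO_mul_Tri {A : Matrix (Fin n) (Fin n) ℝ} (hA : 0 < A.det) :
    ∃ Q : SO n, ∃ T ∈ Tri c P, A = Q.1 * T := by
  let f : Fin n → EuclideanSpace ℝ (Fin n) := fun j => WithLp.toLp 2 (A.col j)
  let b := InnerProductSpace.gramSchmidtOrthonormalBasis (𝕜 := ℝ) (by simp) f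
  let O : Matrix (Fin n) (Fin n) ℝ := Matrix.of fun i j => b j i
  have hO : Oᵀ * O = 1 := by
    ext i j
    have := orthonormal_iff_ite.1 b.orthonormal j i
    rw [PiLp.inner_apply] at this
    simpa [O, Matrix.mul_apply, Matrix.one_apply, eq_comm] using this
  let R := Oᵀ * A
  have hR : ∀ i j, j < i → R i j = 0 := by
    intro i j hij
    have := InnerProductSpace.gramSchmidtOrthonormalBasis_inv_triangular (𝕜 := ℝ)
      (by simp) f hij
    rw [PiLp.inner_apply] at this
    simpa [R, O, b, f, Matrix.mul_apply, mul_comm] using this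
  have hOR : O * R = A := by rw [← mul_assoc, mul_eq_one_comm.1 hO, one_mul]
  have hdetO : O.det * O.det = 1 := by
    have := congrArg Matrix.det hO
    rwa [Matrix.det_mul, Matrix.det_transpose, Matrix.det_one] at this
  have hRii : ∀ i, R i i ≠ 0 := by
    intro i h
    have : R.det = 0 := by
      rw [Matrix.det_of_isUpperTriangular (M := R) fun i j h => hR i j h]
      exact Finset.prod_eq_zero (Finset.mem_univ i) h
    rw [← hOR, Matrix.det_mul, this, mul_zero] at hA
    exact lt_irrefl _ hA
  -- The signs of the diagonal of `R` are moved into the orthogonal factor; its determinant is then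
  -- 1 because `det A > 0`.
  let s : Fin n → ℝ := fun i => SignType.sign (R i i)
  have hs : ∀ i, s i * s i = 1 := by
    intro i
    rcases (hRii i).lt_or_gt with h | h <;> simp [s, h]
  have hD : Matrix.diagonal s * Matrix.diagonal s = 1 := by
    rw [Matrix.diagonal_mul_diagonal]
    simp [hs]
  have hTR : Matrix.diagonal s * R ∈ Tri c P := by
    refine mem_Tri_of_isUpperTriangular (fun i j h => ?_) fun i => ?_
    · rw [Matrix.diagonal_mul, hR i j h, mul_zero]
    · rw [Matrix.diagonal_mul, sign_mul_self]
      exact abs_pos.2 (hRii i)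
  have hQo : (O * Matrix.diagonal s)ᵀ * (O * Matrix.diagonal s) = 1 := by
    rw [Matrix.transpose_mul, Matrix.diagonal_transpose, mul_assoc, ← mul_assoc Oᵀ, hO, one_mul, hD]
  have hQA : A = O * Matrix.diagonal s * (Matrix.diagonal s * R) := by
    rw [mul_assoc, ← mul_assoc (Matrix.diagonal s), hD, one_mul, hOR]
  have hQd : (O * Matrix.diagonal s).det = 1 := by
    have h1 := congrArg Matrix.det hQo
    rw [Matrix.det_mul, Matrix.det_transpose, Matrix.det_one] at h1
    have h2 : 0 < (O * Matrix.diagonal s).det :=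
      pos_of_mul_pos_left (by rw [← Matrix.det_mul, ← hQA]; exact hA) (det_pos_of_mem_Tri hTR).le
    nlinarith
  exact ⟨⟨O * Matrix.diagonal s, Matrix.mem_specialOrthogonalGroup_iff.2
    ⟨(Matrix.mem_orthogonalGroup_iff' _ _).2 hQo, hQd⟩⟩, _, hTR, hQA⟩

end Algebra

/-! ### Compactness, separation and continuity of the flag map -/

section Topology

instance : IsTopologicalGroup (SO n) where
  continuous_inv := continuous_induced_rng.2
    (show Continuous fun A : SO n => A.1ᵀ from continuous_subtype_val.matrix_transpose)

instance : CompactSpace (SO n) := by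
  refine isCompact_iff_compactSpace.1 ?_
  have hclosed : IsClosed ((Matrix.specialOrthogonalGroup (Fin n) ℝ : Submonoid _) :
      Set (Matrix (Fin n) (Fin n) ℝ)) := by
    have : ((Matrix.specialOrthogonalGroup (Fin n) ℝ : Submonoid _) :
        Set (Matrix (Fin n) (Fin n) ℝ)) = {A | A * Aᵀ = 1} ∩ {A | A.det = 1} := by
      ext A
      simp only [SetLike.mem_coe, Matrix.mem_specialOrthogonalGroup_iff,
        Matrix.mem_orthogonalGroup_iff, mem_inter_iff, mem_ofPred_eq]
    rw [this]
    exact (isClosed_eq (by fun_prop) continuous_const).inter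
      (isClosed_eq (Continuous.matrix_det continuous_id) continuous_const)
  refine IsCompact.of_isClosed_subset (isCompact_univ_pi fun i : Fin n =>
    isCompact_univ_pi fun j : Fin n => isCompact_Icc (a := (-1 : ℝ)) (b := 1)) hclosed ?_
  intro A hA i _ j _
  have := entry_norm_bound_of_unitary (Matrix.mem_specialOrthogonalGroup_iff.1 hA).1 i j
  exact abs_le.1 this

theorem isClosed_SG : IsClosed (SG c P : Set (SO n)) := by
  have : (SG c P : Set (SO n)) =
      (⋂ i, ⋂ j, ⋂ _ : c.index i ≠ c.index j, {A | A.1 i j = 0}) ∩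
      ⋂ α ∈ P.parts, {A | (blockPart c α A.1).det = 1} := by
    ext A
    simp only [mem_inter_iff, mem_iInter, mem_ofPred_eq]
    rfl
  rw [this]
  refine IsClosed.inter ?_ ?_
  · exact isClosed_iInter fun i => isClosed_iInter fun j => isClosed_iInter fun _ =>
      isClosed_eq (continuous_subtype_val.matrix_elem i j) continuous_const
  · refine isClosed_biInter fun α _ => isClosed_eq ?_ continuous_const
    exact Continuous.matrix_det (Continuous.matrix_submatrix continuous_subtype_val _ _)

theorem isOpenQuotientMap_proj : IsOpenQuotientMap (proj c P) :=
  QuotientGroup.isOpenQuotientMap_mk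

theorem continuous_proj : Continuous (proj c P) := (isOpenQuotientMap_proj c P).continuous

instance : CompactSpace (Flag c P) := inferInstanceAs (CompactSpace (SO n ⧸ SG c P))

instance : T2Space (Flag c P) := by
  rw [t2Space_iff_of_isOpenQuotientMap (isOpenQuotientMap_proj c P)]
  have : {q : SO n × SO n | proj c P q.1 = proj c P q.2} =
      (fun q : SO n × SO n => q.1⁻¹ * q.2) ⁻¹' (SG c P : Set (SO n)) := by
    ext q
    exact proj_eq_proj
  rw [this]
  exact (isClosed_SG c P).preimage (by fun_prop)

open Classical in
/-- The flag of the orthogonal factor in a decomposition of a matrix with positive determinant into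
an orthogonal and a block upper triangular matrix. -/
def flagOf (A : Matrix (Fin n) (Fin n) ℝ) : Flag c P :=
  if h : ∃ Q : SO n, ∃ T ∈ Tri c P, A = Q.1 * T then proj c P h.choose else proj c P 1

variable {c P} in
theorem flagOf_mul (Q : SO n) {T : Matrix (Fin n) (Fin n) ℝ} (hT : T ∈ Tri c P) :
    flagOf c P (Q.1 * T) = proj c P Q := by
  have h : ∃ Q' : SO n, ∃ T' ∈ Tri c P, Q.1 * T = Q'.1 * T' := ⟨Q, T, hT, rfl⟩
  rw [flagOf, dif_pos h]
  obtain ⟨T', hT', h'⟩ := h.choose_spec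
  exact proj_eq_of_mul_eq hT' hT h'.symm

/-- The coordinates of the matrices with positive determinant. -/
abbrev DetPos (n : ℕ) : Type := {z : Fin n × Fin n → ℝ // 0 < (toMat z).det}

theorem continuous_toMat {ι : Type*} : Continuous (toMat : (ι × ι → ℝ) → Matrix ι ι ℝ) := by
  unfold toMat; fun_prop

/-- The preimage of a closed set is the projection, along the compact group `SO(n)`, of a closed set
of pairs `(Q, A)` with `Qᵀ A` block triangular. -/
theorem continuous_flagOf : Continuous fun z : DetPos n => flagOf c P (toMat z.1) := by
  refine continuous_iff_isClosed.2 fun C hC => ?_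
  have hmul : Continuous fun q : SO n × DetPos n => q.1.1ᵀ * toMat q.2.1 :=
    (continuous_subtype_val.comp continuous_fst).matrix_transpose.matrix_mul
      (continuous_toMat.comp (continuous_subtype_val.comp continuous_snd))
  have hBT : IsClosed {T : Matrix (Fin n) (Fin n) ℝ | T.BlockTriangular c.index} := by
    simp only [Matrix.BlockTriangular, ofPred_forall]
    exact isClosed_iInter fun i => isClosed_iInter fun j => isClosed_iInter fun _ =>
      isClosed_eq (by fun_prop) continuous_const
  -- The weak inequality keeps the set closed; it is strict automatically, since `det A ≠ 0` makes
  -- every block determinant nonzero.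
  have hpos : IsClosed (⋂ α ∈ P.parts,
      {q : SO n × DetPos n | 0 ≤ (blockPart c α (q.1.1ᵀ * toMat q.2.1)).det}) :=
    isClosed_biInter fun α _ => isClosed_le continuous_const
      (Continuous.matrix_det (hmul.matrix_submatrix _ _))
  have hN := (hC.preimage ((continuous_proj c P).comp
    (continuous_fst (X := SO n) (Y := DetPos n)))).inter ((hBT.preimage hmul).inter hpos)
  convert isClosedMap_snd_of_compactSpace _ hN using 1
  ext z
  simp only [mem_preimage, mem_image, mem_inter_iff, mem_iInter, mem_ofPred_eq, Prod.exists,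
    exists_eq_right, Function.comp_apply]
  constructor
  · intro hz
    obtain ⟨Q, T, hT, hA⟩ := exists_SO_mul_Tri (c := c) (P := P) z.2
    have hQ : Q.1ᵀ * toMat z.1 = T := by rw [hA, ← mul_assoc, transpose_mul_SO, one_mul]
    rw [hA, flagOf_mul Q hT] at hz
    exact ⟨Q, hz, by rw [hQ]; exact ⟨hT.1, fun α hα => (hT.2 α hα).le⟩⟩
  · rintro ⟨Q, hQ, hT, hpos⟩
    have hdet : (Q.1ᵀ * toMat z.1).det ≠ 0 := by
      rw [Matrix.det_mul, Matrix.det_transpose, det_SO, one_mul]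
      exact z.2.ne'
    have hTri : Q.1ᵀ * toMat z.1 ∈ Tri c P := by
      refine ⟨hT, fun α hα => lt_of_le_of_ne (hpos α hα) fun h => ?_⟩
      rw [det_blockPart hT, eq_comm, Finset.prod_eq_zero_iff] at h
      obtain ⟨j, -, hj⟩ := h
      rw [det_eq_prod_blockDet hT] at hdet
      exact hdet (Finset.prod_eq_zero (Finset.mem_univ j) hj)
    have hA : toMat z.1 = Q.1 * (Q.1ᵀ * toMat z.1) := by
      rw [← mul_assoc, mul_transpose_SO, one_mul]
    rw [hA, flagOf_mul Q hTri]
    exact hQ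

end Topology

end

section

variable {n : ℕ} (c : Composition n)

/-! ### Matrix entries split at the diagonal blocks -/

section Coordinates

/-- A position strictly below the diagonal blocks. -/
def IsLower (q : Fin n × Fin n) : Prop := c.index q.2 < c.index q.1

instance : DecidablePred (IsLower c) := fun _ => inferInstanceAs (Decidable (_ < _))

variable {c} in
theorem CoordIndex.index_lt (s : CoordIndex c) : c.index s.1.1 < c.index s.1.2 :=
  lt_of_le_of_ne (monotone_index c s.2.1.le) s.2.2

/-- The positions strictly below the diagonal blocks are the transposes of those above. -/
def lowerEquiv : CoordIndex c ≃ {q : Fin n × Fin n // IsLower c q} where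
  toFun s := ⟨s.1.swap, s.index_lt⟩
  invFun q := ⟨q.1.swap, (monotone_index c).reflect_lt q.2, ne_of_lt q.2⟩
  left_inv _ := rfl
  right_inv _ := rfl

/-- The entries below the diagonal blocks, as a coordinate vector. -/
def lowPart : (Fin n × Fin n → ℝ) →L[ℝ] Coord c :=
  ContinuousLinearMap.pi fun s => ContinuousLinearMap.proj s.1.swap

/-- The vector with the entries below the diagonal blocks deleted. -/
def upPart : (Fin n × Fin n → ℝ) →L[ℝ] (Fin n × Fin n → ℝ) :=
  ContinuousLinearMap.pi fun q => if IsLower c q then 0 else ContinuousLinearMap.proj q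

theorem lowPart_apply (z : Fin n × Fin n → ℝ) (s : CoordIndex c) :
    lowPart c z s = z s.1.swap := rfl

theorem upPart_apply (z : Fin n × Fin n → ℝ) (q : Fin n × Fin n) :
    upPart c z q = if IsLower c q then 0 else z q := by
  by_cases h : IsLower c q <;> simp [upPart, h]

theorem upPart_blockTriangular (z : Fin n × Fin n → ℝ) :
    (toMat (upPart c z)).BlockTriangular c.index := fun i j h => by
  rw [toMat, Matrix.of_apply, upPart_apply, if_pos (show IsLower c (i, j) from h)]

theorem lowerCoord_eq_zero {q : Fin n × Fin n} (hq : ¬IsLower c q) :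
    lowPart c (Pi.single q 1) = 0 := by
  ext s
  rw [lowPart_apply, Pi.single_apply, if_neg, Pi.zero_apply]
  rintro rfl
  exact hq s.index_lt

theorem lowPart_single (s : CoordIndex c) :
    lowPart c (Pi.single s.1.swap 1) = Pi.single s 1 := by
  ext t
  rw [lowPart_apply, Pi.single_apply, Pi.single_apply]
  simp [Prod.swap_inj, Subtype.ext_iff]

theorem upPart_single_of_isLower {q : Fin n × Fin n} (hq : IsLower c q) :
    upPart c (Pi.single q 1) = 0 := by
  ext r
  rw [upPart_apply, Pi.zero_apply]
  by_cases h : r = q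
  · rw [if_pos (h ▸ hq)]
  · rw [Pi.single_eq_of_ne h, ite_self]

theorem upPart_single_of_not {q : Fin n × Fin n} (hq : ¬IsLower c q) :
    upPart c (Pi.single q 1) = Pi.single q 1 := by
  ext r
  rw [upPart_apply]
  by_cases h : r = q
  · rw [if_neg (h ▸ hq)]
  · rw [Pi.single_eq_of_ne h, ite_self]

theorem blockDet_upPart (z : Fin n × Fin n → ℝ) :
    blockDet c.index (toMat (upPart c z)) = blockDet c.index (toMat z) := by
  ext j
  unfold blockDet
  congr 1
  ext ⟨p, hp⟩ ⟨q, hq⟩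
  simp [toMat, upPart_apply, IsLower, hp, hq]

/-- The number of coordinates in the blocks after the `j`-th one. -/
def tailCard (j : Fin c.length) : ℕ := Fintype.card {i : Fin n // j < c.index i}

end Coordinates

/-! ### The Jacobian determinant -/

section Determinant

/-- The action of the block triangular matrix `T` on the rows of matrices supported strictly below
the diagonal blocks. -/
def rowAction (T : Matrix (Fin n) (Fin n) ℝ) :
    Matrix {q : Fin n × Fin n // IsLower c q} {q : Fin n × Fin n // IsLower c q} ℝ :=
  Matrix.of fun r q => if r.1.1 = q.1.1 then T r.1.2 q.1.2 else 0

variable {c}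

/-- Graded by the block of the column, the matrix is block triangular. Its `j`-th diagonal block is
`1 ⊗ T_jj`, with one copy of `T_jj` for each row below block `j`. -/
theorem det_rowAction {T : Matrix (Fin n) (Fin n) ℝ} (hT : T.BlockTriangular c.index) :
    (rowAction c T).det = ∏ j, blockDet c.index T j ^ tailCard c j := by
  have h : (rowAction c T).BlockTriangular fun q => c.index q.1.2 := by
    intro r q hrq
    rw [rowAction, Matrix.of_apply, hT hrq, ite_self]
  rw [h.det_fintype]
  refine Finset.prod_congr rfl fun j _ => ?_
  let e : {q : {q : Fin n × Fin n // IsLower c q} // c.index q.1.2 = j} ≃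
      {i : Fin n // j < c.index i} × {k : Fin n // c.index k = j} :=
    { toFun := fun q => (⟨q.1.1.1, by have := q.1.2; rwa [IsLower, q.2] at this⟩, ⟨q.1.1.2, q.2⟩)
      invFun := fun p => ⟨⟨(p.1.1, p.2.1), by
        change c.index p.2.1 < c.index p.1.1
        rw [p.2.2]
        exact p.1.2⟩, p.2.2⟩
      left_inv := fun _ => rfl
      right_inv := fun _ => rfl }
  have hk : (rowAction c T).toSquareBlock (fun q => c.index q.1.2) j =
      (Matrix.kronecker (1 : Matrix {i : Fin n // j < c.index i} {i : Fin n // j < c.index i} ℝ)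
        (T.submatrix (Subtype.val : {k : Fin n // c.index k = j} → Fin n)
          Subtype.val)).submatrix e e := by
    ext r q
    simp [rowAction, Matrix.toSquareBlock_def, e, Matrix.kroneckerMap_apply, Matrix.one_apply]
  rw [hk, Matrix.det_submatrix_equiv_self]
  refine (Matrix.det_kronecker _ _).trans ?_
  rw [Matrix.det_one, one_pow, one_mul]
  rfl

/-- The differential of the chart map, up to a rotation. -/
def jacobian (X : CoordIndex c → Matrix (Fin n) (Fin n) ℝ) (T : Matrix (Fin n) (Fin n) ℝ) :
    (Fin n × Fin n → ℝ) →ₗ[ℝ] (Fin n × Fin n → ℝ) where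
  toFun w q := ∑ s, lowPart c w s * (X s * T) q.1 q.2 + upPart c w q
  map_add' w w' := by
    ext q
    simp only [map_add, Pi.add_apply, add_mul, Finset.sum_add_distrib]
    ring
  map_smul' a w := by
    ext q
    simp only [map_smul, Pi.smul_apply, smul_eq_mul, RingHom.id_apply, mul_add, Finset.mul_sum,
      mul_assoc]

/-- The matrix of the entries below the diagonal blocks of a family of matrices. -/
def lowerEntries (X : CoordIndex c → Matrix (Fin n) (Fin n) ℝ) :
    Matrix (CoordIndex c) (CoordIndex c) ℝ :=
  Matrix.of fun p s => X s p.1.2 p.1.1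

/-- The upper coordinates map identically to themselves and contribute nothing below, so only the
lower-to-lower block counts. As `T` is block upper triangular, the lower entries of `X T` involve
only those of `X`, and this block factors. -/
theorem det_jacobian (X : CoordIndex c → Matrix (Fin n) (Fin n) ℝ)
    {T : Matrix (Fin n) (Fin n) ℝ} (hT : T.BlockTriangular c.index) :
    LinearMap.det (jacobian X T) =
      (lowerEntries X).det * ∏ j, blockDet c.index T j ^ tailCard c j := by
  rw [← LinearMap.det_toMatrix']
  have happ : ∀ q q', LinearMap.toMatrix' (jacobian X T) q q' =
      ∑ s, lowPart c (Pi.single q' 1) s * (X s * T) q.1 q.2 + upPart c (Pi.single q' 1) q :=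
    fun q q' => LinearMap.toMatrix'_apply _ _ _
  rw [Matrix.twoBlockTriangular_det' _ (IsLower c)]
  · have h2 : (LinearMap.toMatrix' (jacobian X T)).toSquareBlockProp (fun q => ¬IsLower c q) = 1 := by
      ext q q'
      rw [Matrix.toSquareBlockProp_def, Matrix.of_apply, happ, lowerCoord_eq_zero c q'.2,
        upPart_single_of_not c q'.2]
      simp [Matrix.one_apply, Pi.single_apply, Subtype.ext_iff]
    have h1 : (LinearMap.toMatrix' (jacobian X T)).toSquareBlockProp (IsLower c) =
        (rowAction c T)ᵀ * (lowerEntries X).submatrix (lowerEquiv c).symm (lowerEquiv c).symm := by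
      ext q q'
      obtain ⟨s, rfl⟩ := (lowerEquiv c).surjective q'
      rw [Matrix.toSquareBlockProp_def, Matrix.of_apply, happ,
        upPart_single_of_isLower c (lowerEquiv c s).2]
      have hs : ((lowerEquiv c s).1 : Fin n × Fin n) = s.1.swap := rfl
      rw [hs, lowPart_single, Pi.zero_apply, add_zero, Matrix.mul_apply]
      simp only [Pi.single_apply, ite_mul, one_mul, zero_mul, Finset.sum_ite_eq',
        Finset.mem_univ, if_true, Matrix.transpose_apply,
        Matrix.submatrix_apply, Equiv.symm_apply_apply]
      rw [Matrix.mul_apply]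
      have hr : ∀ r : {q : Fin n × Fin n // IsLower c q},
          rowAction c T r q * lowerEntries X ((lowerEquiv c).symm r) s =
          if r.1.1 = q.1.1 then X s r.1.1 r.1.2 * T r.1.2 q.1.2 else 0 := by
        intro r
        rw [rowAction, Matrix.of_apply, ite_mul, zero_mul, mul_comm]
        rfl
      simp_rw [hr]
      rw [← Finset.sum_subtype (Finset.univ.filter (IsLower c)) (by simp)
        (fun r => if r.1 = q.1.1 then X s r.1 r.2 * T r.2 q.1.2 else 0), Finset.sum_filter,
        Fintype.sum_prod_type]
      refine Eq.symm ((Finset.sum_eq_single q.1.1 ?_ ?_).trans ?_)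
      rotate_left 2
      · refine Finset.sum_congr rfl fun k _ => ?_
        by_cases hk : IsLower c (q.1.1, k)
        · simp [hk]
        -- A column `k` not below the blocks in this row lies in a later block than `q.1.2`, where
        -- `T` vanishes.
        · rw [if_neg hk, hT (show c.index q.1.2 < c.index k from
            lt_of_lt_of_le q.2 (not_lt.1 hk)), mul_zero]
      · intro i _ hi
        simp [hi]
      · simp
    rw [h1, h2, Matrix.det_one, mul_one, Matrix.det_mul, Matrix.det_transpose,
      Matrix.det_submatrix_equiv_self, det_rowAction hT, mul_comm]
  · intro q hq q' hq'
    rw [happ, lowerCoord_eq_zero c hq', upPart_single_of_not c hq',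
      Pi.single_eq_of_ne (by rintro rfl; exact hq' hq)]
    simp

end Determinant

/-! ### The submersion metric as a Gram matrix -/

section Metric

variable {c}

/-- The trace counts each unordered pair of coordinates twice, and the factor `1/2` undoes this. So
the lower entries are orthonormal coordinates and no constant enters the volume. -/
theorem rotInner_horizontal {X Y : Matrix (Fin n) (Fin n) ℝ} (hX : Xᵀ = -X) (hY : Yᵀ = -Y) :
    rotInner (horizontal c X) (horizontal c Y) =
      ∑ p : CoordIndex c, X p.1.2 p.1.1 * Y p.1.2 p.1.1 := by
  have hX' : ∀ i j, X j i = -X i j := fun i j => congrFun (congrFun hX i) j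
  have hY' : ∀ i j, Y j i = -Y i j := fun i j => congrFun (congrFun hY i) j
  let f : Fin n → Fin n → ℝ := fun i j => if c.index i = c.index j then 0 else X j i * Y j i
  have hf : ∀ i j, f i j = f j i := by
    intro i j
    by_cases h : c.index i = c.index j
    · simp [f, h]
    · simp [f, h, Ne.symm h, hX' i j, hY' i j]
  let g : Fin n → Fin n → ℝ := fun i j => if i < j then f i j else 0
  have hfg : ∀ i j, f i j = g i j + g j i := by
    intro i j
    rcases lt_trichotomy i j with h | rfl | h
    · simp [g, h, h.not_gt]
    · simp [g, f]
    · simp [g, h, h.not_gt, hf i j]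
  have h1 : rotInner (horizontal c X) (horizontal c Y) = (∑ i, ∑ j, f i j) / 2 := by
    rw [rotInner, Matrix.trace]
    congr 1
    refine Finset.sum_congr rfl fun i _ => ?_
    rw [Matrix.diag_apply, Matrix.mul_apply]
    refine Finset.sum_congr rfl fun j _ => ?_
    by_cases h : c.index i = c.index j
    · simp [horizontal, f, h]
    · simp [horizontal, f, h, Ne.symm h]
  have h2 : ∑ i, ∑ j, f i j = 2 * ∑ i, ∑ j, g i j := by
    simp_rw [hfg, Finset.sum_add_distrib]
    rw [two_mul]
    congr 1
    exact Finset.sum_comm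
  rw [h1, h2, mul_div_cancel_left₀ _ two_ne_zero]
  rw [← Finset.sum_subtype (Finset.univ.filter fun p : Fin n × Fin n =>
    p.1 < p.2 ∧ c.index p.1 ≠ c.index p.2) (by simp) (fun p => X p.2 p.1 * Y p.2 p.1),
    Finset.sum_filter, Fintype.sum_prod_type]
  refine Finset.sum_congr rfl fun i _ => Finset.sum_congr rfl fun j _ => ?_
  by_cases h : i < j <;> by_cases h' : c.index i = c.index j <;> simp [g, f, h, h']

/-- Differentiate `ψᵀ ψ = 1`. -/
theorem transpose_partialDeriv {ψ : Coord c → SO n} {u : Coord c}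
    (hψ : ∀ i j, DifferentiableAt ℝ (fun v => (ψ v).1 i j) u) (s : CoordIndex c) :
    ((ψ u).1ᵀ * partialDeriv c ψ u s)ᵀ = -((ψ u).1ᵀ * partialDeriv c ψ u s) := by
  ext i j
  have hconst : (fun v : Coord c => ∑ k, (ψ v).1 k i * (ψ v).1 k j) =
      fun _ => (1 : Matrix (Fin n) (Fin n) ℝ) i j := by
    ext v
    rw [← transpose_mul_SO (ψ v), Matrix.mul_apply]
    rfl
  have hd : HasFDerivAt (fun v : Coord c => ∑ k, (ψ v).1 k i * (ψ v).1 k j)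
      (∑ k, ((ψ u).1 k i • fderiv ℝ (fun v => (ψ v).1 k j) u +
        (ψ u).1 k j • fderiv ℝ (fun v => (ψ v).1 k i) u)) u :=
    HasFDerivAt.fun_sum fun k _ => (hψ k i).hasFDerivAt.mul (hψ k j).hasFDerivAt
  rw [hconst] at hd
  have h0 := congrArg (fun L : Coord c →L[ℝ] ℝ => L (Pi.single s 1))
    (hd.unique (hasFDerivAt_const _ _))
  simp only [_root_.sum_apply, _root_.add_apply,
    _root_.smul_apply, smul_eq_mul, _root_.zero_apply,
    Finset.sum_add_distrib] at h0
  simp only [Matrix.transpose_apply, Matrix.neg_apply, Matrix.mul_apply, partialDeriv,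
    Matrix.of_apply]
  linarith

theorem metricMatrix_eq {ψ : Coord c → SO n} {u : Coord c}
    (hψ : ∀ i j, DifferentiableAt ℝ (fun v => (ψ v).1 i j) u) :
    metricMatrix c ψ u = (lowerEntries fun s => (ψ u).1ᵀ * partialDeriv c ψ u s)ᵀ *
      lowerEntries fun s => (ψ u).1ᵀ * partialDeriv c ψ u s := by
  ext s t
  rw [metricMatrix, Matrix.of_apply, rotInner_horizontal (transpose_partialDeriv hψ s)
    (transpose_partialDeriv hψ t), Matrix.mul_apply]
  rfl

theorem sqrt_det_metricMatrix {ψ : Coord c → SO n} {u : Coord c}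
    (hψ : ∀ i j, DifferentiableAt ℝ (fun v => (ψ v).1 i j) u) :
    √(metricMatrix c ψ u).det =
      |(lowerEntries fun s => (ψ u).1ᵀ * partialDeriv c ψ u s).det| := by
  rw [metricMatrix_eq hψ, Matrix.det_mul, Matrix.det_transpose, Real.sqrt_mul_self_eq_abs]

end Metric

/-! ### The differential of `(u, T) ↦ ψ(u) T` -/

section Derivative

variable {c}

/-- The map `(u, T) ↦ ψ(u) T`, in the coordinates in which `u` fills the positions below the
diagonal blocks and `T` the other ones. -/
def chartMap (ψ : Coord c → SO n) (z : Fin n × Fin n → ℝ) : Fin n × Fin n → ℝ :=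
  fun q => ((ψ (lowPart c z)).1 * toMat (upPart c z)) q.1 q.2

theorem toMat_chartMap (ψ : Coord c → SO n) (z : Fin n × Fin n → ℝ) :
    toMat (chartMap ψ z) = (ψ (lowPart c z)).1 * toMat (upPart c z) := rfl

/-- Left multiplication by a square matrix. -/
def mulCols (Q : Matrix (Fin n) (Fin n) ℝ) : (Fin n × Fin n → ℝ) →ₗ[ℝ] (Fin n × Fin n → ℝ) where
  toFun z q := (Q * toMat z) q.1 q.2
  map_add' x y := by
    ext q
    simp [toMat, Matrix.mul_apply, mul_add, Finset.sum_add_distrib]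
  map_smul' a x := by
    ext q
    simp [toMat, Matrix.mul_apply, Finset.mul_sum, mul_left_comm]

theorem sum_sq_mulCols (Q : SO n) (x : Fin n × Fin n → ℝ) :
    ∑ q, mulCols Q.1 x q ^ 2 = ∑ q, x q ^ 2 := by
  rw [Fintype.sum_prod_type_right, Fintype.sum_prod_type_right]
  refine Finset.sum_congr rfl fun j _ => ?_
  have h := sum_sq_vecMul (O := Q.1ᵀ) (by rw [Matrix.transpose_transpose, transpose_mul_SO])
    fun k => x (k, j)
  rw [← h]
  refine Finset.sum_congr rfl fun i _ => ?_
  rw [Matrix.vecMul_transpose]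
  rfl

/-- The differential of the chart map. -/
def chartDeriv (ψ : Coord c → SO n) (z : Fin n × Fin n → ℝ) :
    (Fin n × Fin n → ℝ) →L[ℝ] (Fin n × Fin n → ℝ) :=
  LinearMap.toContinuousLinearMap (mulCols (ψ (lowPart c z)).1 ∘ₗ
    jacobian (fun s => (ψ (lowPart c z)).1ᵀ * partialDeriv c ψ (lowPart c z) s)
      (toMat (upPart c z)))

/-- The product rule, with `∂ₛψ = ψ (ψᵀ ∂ₛψ)` used to pull the rotation `ψ` out on the left. -/
theorem hasFDerivAt_chartMap {ψ : Coord c → SO n} {z : Fin n × Fin n → ℝ}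
    (hψ : ∀ i j, DifferentiableAt ℝ (fun v => (ψ v).1 i j) (lowPart c z)) :
    HasFDerivAt (chartMap ψ) (chartDeriv ψ z) z := by
  rw [hasFDerivAt_pi']
  intro q
  have h1 : HasFDerivAt (fun z => ∑ k, (ψ (lowPart c z)).1 q.1 k * upPart c z (k, q.2))
      (∑ k, ((ψ (lowPart c z)).1 q.1 k •
          (ContinuousLinearMap.proj (R := ℝ) (φ := fun _ => ℝ) (k, q.2)).comp (upPart c) +
        upPart c z (k, q.2) •
          (fderiv ℝ (fun v => (ψ v).1 q.1 k) (lowPart c z)).comp (lowPart c))) z := by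
    refine HasFDerivAt.fun_sum fun k _ => HasFDerivAt.mul ?_ ?_
    · exact HasFDerivAt.comp z (hψ q.1 k).hasFDerivAt (lowPart c).hasFDerivAt
    · exact ((ContinuousLinearMap.proj (R := ℝ) (φ := fun _ => ℝ) (k, q.2)).comp
        (upPart c)).hasFDerivAt
  refine h1.congr_fderiv ?_
  ext w
  set u := lowPart c z
  set T := toMat (upPart c z)
  have hD : ∀ k, fderiv ℝ (fun v => (ψ v).1 q.1 k) u (lowPart c w) =
      ∑ s, lowPart c w s * partialDeriv c ψ u s q.1 k := by
    intro k
    conv_lhs => rw [← Finset.univ_sum_single (lowPart c w), map_sum]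
    refine Finset.sum_congr rfl fun s _ => ?_
    have : (Pi.single s (lowPart c w s) : Coord c) = lowPart c w s • Pi.single s 1 := by
      rw [← Pi.single_smul, smul_eq_mul, mul_one]
    rw [this, map_smul]
    rfl
  have hmat : toMat (jacobian (fun s => (ψ u).1ᵀ * partialDeriv c ψ u s) T w) =
      ∑ s, lowPart c w s • ((ψ u).1ᵀ * partialDeriv c ψ u s * T) + toMat (upPart c w) := by
    ext i j
    simp [toMat, jacobian, Matrix.sum_apply]
  have hR : chartDeriv ψ z w q = ((ψ u).1 * (∑ s, lowPart c w s •
      ((ψ u).1ᵀ * partialDeriv c ψ u s * T) + toMat (upPart c w))) q.1 q.2 := by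
    rw [← hmat]
    rfl
  have hQ : (ψ u).1 * (∑ s, lowPart c w s • ((ψ u).1ᵀ * partialDeriv c ψ u s * T) +
      toMat (upPart c w)) =
      (∑ s, lowPart c w s • partialDeriv c ψ u s) * T + (ψ u).1 * toMat (upPart c w) := by
    rw [mul_add, Finset.mul_sum, Finset.sum_mul]
    congr 1
    refine Finset.sum_congr rfl fun s _ => ?_
    rw [Matrix.mul_smul, Matrix.smul_mul, ← mul_assoc, ← mul_assoc, mul_transpose_SO, one_mul]
  rw [ContinuousLinearMap.comp_apply, ContinuousLinearMap.proj_apply, hR, hQ, Matrix.add_apply,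
    Matrix.mul_apply, Matrix.mul_apply, ← Finset.sum_add_distrib]
  simp only [_root_.sum_apply, _root_.add_apply,
    _root_.smul_apply, ContinuousLinearMap.comp_apply, smul_eq_mul,
    ContinuousLinearMap.proj_apply, hD, Matrix.sum_apply, Matrix.smul_apply]
  refine Finset.sum_congr rfl fun k _ => ?_
  rw [add_comm, mul_comm (upPart c z _)]
  rfl

theorem abs_det_chartDeriv {ψ : Coord c → SO n} {z : Fin n × Fin n → ℝ}
    (hψ : ∀ i j, DifferentiableAt ℝ (fun v => (ψ v).1 i j) (lowPart c z)) :
    |(chartDeriv ψ z).det| = √(metricMatrix c ψ (lowPart c z)).det *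
      ∏ j, |blockDet c.index (toMat z) j| ^ tailCard c j := by
  have h : (chartDeriv ψ z).det = LinearMap.det (mulCols (ψ (lowPart c z)).1) * LinearMap.det
      (jacobian (fun s => (ψ (lowPart c z)).1ᵀ * partialDeriv c ψ (lowPart c z) s)
        (toMat (upPart c z))) := by
    rw [← LinearMap.det_comp]
    rfl
  rw [h, abs_mul, abs_det_of_sq (sum_sq_mulCols _), one_mul,
    det_jacobian _ (upPart_blockTriangular c z), abs_mul, ← sqrt_det_metricMatrix hψ,
    Finset.abs_prod, blockDet_upPart]
  simp_rw [abs_pow]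

end Derivative

end

section

variable {n : ℕ} (c : Composition n) (P : Finpartition (Finset.univ : Finset (Fin c.length)))

/-! ### Change of variables in a local parametrization -/

section ChangeOfVariables

open Classical in
/-- The function of the diagonal blocks that enters the change of variables. -/
def blockWeight (z : Fin n × Fin n → ℝ) : ENNReal :=
  if ∀ α ∈ P.parts, 0 < ∏ j ∈ α, blockDet c.index (toMat z) j then
    ∏ j, detPow (tailCard c j) (blockDet c.index (toMat z) j) else 0

theorem measurable_blockWeight : Measurable (blockWeight c P) := by
  have h := (measurePreserving_blockDet c.index).measurable
  have h' : ∀ j, Measurable fun z : Fin n × Fin n → ℝ => blockDet c.index (toMat z) j :=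
    fun j => (measurable_pi_apply j).comp h
  refine Measurable.ite ?_ (Finset.measurable_prod _ fun j _ =>
    (measurable_detPow _).comp (h' j)) measurable_const
  simp only [Set.ofPred_forall]
  refine Finset.measurableSet_biInter _ fun α _ => ?_
  exact measurableSet_lt measurable_const (Finset.measurable_prod _ fun j _ => h' j)

theorem lintegral_blockWeight :
    ∫⁻ z, blockWeight c P z ∂gauss (Fin n × Fin n) = triangularMass c.index P (tailCard c) := rfl

variable {c P}

theorem mem_Tri_upPart {z : Fin n × Fin n → ℝ} : toMat (upPart c z) ∈ Tri c P ↔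
    ∀ α ∈ P.parts, 0 < ∏ j ∈ α, blockDet c.index (toMat z) j := by
  have h : ∀ α, (blockPart c α (toMat (upPart c z))).det =
      ∏ j ∈ α, blockDet c.index (toMat z) j := fun α => by
    rw [det_blockPart (upPart_blockTriangular c z), blockDet_upPart]
  simp only [Tri, mem_ofPred_eq, h, upPart_blockTriangular, true_and]

theorem blockWeight_upPart (z : Fin n × Fin n → ℝ) :
    blockWeight c P (upPart c z) = blockWeight c P z := by
  simp only [blockWeight, blockDet_upPart]

theorem blockDet_ne_zero {z : Fin n × Fin n → ℝ} (hz : toMat (upPart c z) ∈ Tri c P)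
    (j : Fin c.length) : blockDet c.index (toMat z) j ≠ 0 := by
  have h := (det_pos_of_mem_Tri hz).ne'
  rw [det_eq_prod_blockDet hz.1, blockDet_upPart, Finset.prod_ne_zero_iff] at h
  exact h j (Finset.mem_univ j)

theorem blockWeight_of_mem {z : Fin n × Fin n → ℝ} (hz : toMat (upPart c z) ∈ Tri c P) :
    blockWeight c P z =
      ENNReal.ofReal (∏ j, |blockDet c.index (toMat z) j| ^ tailCard c j) := by
  rw [blockWeight, if_pos (mem_Tri_upPart.1 hz),
    ENNReal.ofReal_prod_of_nonneg fun j _ => by positivity]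
  exact Finset.prod_congr rfl fun j _ => detPow_of_ne (blockDet_ne_zero hz j)

/-- A vector supported at the positions that are not below the diagonal blocks. -/
def extendUp (y : {q : Fin n × Fin n // ¬IsLower c q} → ℝ) : Fin n × Fin n → ℝ :=
  fun q => if h : IsLower c q then 0 else y ⟨q, h⟩

theorem measurable_extendUp : Measurable (extendUp (c := c)) := by
  refine measurable_pi_lambda _ fun q => ?_
  by_cases h : IsLower c q
  · simp [extendUp, h]
  · simpa [extendUp, h] using measurable_pi_apply _

theorem extendUp_restrict (z : Fin n × Fin n → ℝ) :
    extendUp (c := c) (z ∘ Subtype.val) = upPart c z := by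
  ext q
  rw [upPart_apply]
  by_cases h : IsLower c q <;> simp [extendUp, h]

/-- The separation of the entries below the diagonal blocks from the other ones. -/
def splitEquiv : (Fin n × Fin n → ℝ) ≃ᵐ
    Coord c × ({q : Fin n × Fin n // ¬IsLower c q} → ℝ) :=
  (MeasurableEquiv.piEquivPiSubtypeProd (fun _ => ℝ) (IsLower c)).trans
    (MeasurableEquiv.prodCongr
      (MeasurableEquiv.piCongrLeft (fun _ => ℝ) (lowerEquiv c)).symm (MeasurableEquiv.refl _))

theorem splitEquiv_apply (z : Fin n × Fin n → ℝ) :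
    splitEquiv (c := c) z = (lowPart c z, z ∘ Subtype.val) := by
  refine Prod.ext ?_ rfl
  ext s
  rfl

theorem measurePreserving_splitEquiv : MeasurePreserving (splitEquiv (c := c)) := by
  refine MeasurePreserving.trans (volume_preserving_piEquivPiSubtypeProd _ _) ?_
  exact ((volume_measurePreserving_piCongrLeft (fun _ => ℝ) (lowerEquiv c)).symm _).prod
    (MeasurePreserving.id _)

theorem gaussDensity_chartMap (ψ : Coord c → SO n) (z : Fin n × Fin n → ℝ) :
    gaussDensity (chartMap ψ z) =
      gaussDensity (z ∘ Subtype.val : {q : Fin n × Fin n // ¬IsLower c q} → ℝ) := by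
  have h1 : ∑ q, chartMap ψ z q ^ 2 = ∑ q, upPart c z q ^ 2 := sum_sq_mulCols _ _
  have h2 : ∑ q, upPart c z q ^ 2 = ∑ q : {q : Fin n × Fin n // ¬IsLower c q}, z q ^ 2 := by
    rw [← Finset.sum_subtype (Finset.univ.filter fun q => ¬IsLower c q) (by simp)
      (fun q => z q ^ 2), Finset.sum_filter]
    refine Finset.sum_congr rfl fun q _ => ?_
    by_cases h : IsLower c q <;> simp [upPart_apply, h]
  rw [gaussDensity, h1, h2]
  rfl

/-- Tonelli's theorem separates `u` from `T`. The weight ignores the entries below the blocks, so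
its integral over `T` may be taken against the Gaussian of all entries. -/
theorem lintegral_mul_blockWeight {F : Coord c → ENNReal} (hF : AEMeasurable F) :
    ∫⁻ z, F (lowPart c z) * (gaussDensity (z ∘ Subtype.val :
      {q : Fin n × Fin n // ¬IsLower c q} → ℝ) * blockWeight c P z) =
      (∫⁻ u, F u) * triangularMass c.index P (tailCard c) := by
  have hw : Measurable fun y => blockWeight c P (extendUp (c := c) y) :=
    (measurable_blockWeight c P).comp measurable_extendUp
  have h1 : ∀ z, F (lowPart c z) * (gaussDensity (z ∘ Subtype.val :
      {q : Fin n × Fin n // ¬IsLower c q} → ℝ) * blockWeight c P z) =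
      (fun p : Coord c × ({q : Fin n × Fin n // ¬IsLower c q} → ℝ) =>
        F p.1 * (gaussDensity p.2 * blockWeight c P (extendUp p.2))) (splitEquiv z) := by
    intro z
    simp only [splitEquiv_apply, extendUp_restrict, blockWeight_upPart]
  rw [lintegral_congr h1]
  refine ((measurePreserving_splitEquiv (c := c)).lintegral_comp_emb
    splitEquiv.measurableEmbedding fun p => F p.1 * (gaussDensity p.2 *
      blockWeight c P (extendUp p.2))).trans ?_
  refine (lintegral_prod_mul hF (measurable_gaussDensity.mul hw).aemeasurable).trans ?_
  rw [← lintegral_blockWeight]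
  congr 1
  refine (lintegral_gauss hw).symm.trans ?_
  rw [← (measurePreserving_gauss_comp Subtype.val_injective).lintegral_comp hw]
  simp only [extendUp_restrict, blockWeight_upPart]

theorem LocalParam.differentiableAt (φ : LocalParam c P) {u : Coord c} (hu : u ∈ φ.source)
    (i j : Fin n) : DifferentiableAt ℝ (fun v => (φ.lift v).1 i j) u :=
  ((φ.smooth i j).contDiffAt (φ.isOpen_source.mem_nhds hu)).differentiableAt (by simp)

theorem continuousOn_lift {U : Set (Coord c)} {ψ : Coord c → SO n}
    (h : ∀ i j, ContDiffOn ℝ ∞ (fun u => (ψ u).1 i j) U) : ContinuousOn ψ U := by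
  rw [continuousOn_iff_continuous_domRestrict]
  refine continuous_induced_rng.2 (continuous_matrix fun i j => ?_)
  exact continuousOn_iff_continuous_domRestrict.1 (h i j).continuousOn

theorem continuousOn_metricMatrix {U : Set (Coord c)} (hU : IsOpen U) {ψ : Coord c → SO n}
    (h : ∀ i j, ContDiffOn ℝ ∞ (fun u => (ψ u).1 i j) U) :
    ContinuousOn (metricMatrix c ψ) U := by
  have hp : ∀ s i j, ContinuousOn (fun u => partialDeriv c ψ u s i j) U := fun s i j =>
    ((h i j).continuousOn_fderiv_of_isOpen hU (by simp)).clm_apply continuousOn_const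
  have hh : ∀ s i j, ContinuousOn
      (fun u => horizontal c ((ψ u).1ᵀ * partialDeriv c ψ u s) i j) U := by
    intro s i j
    by_cases hij : c.index i = c.index j
    · simp only [horizontal, Matrix.of_apply, hij, if_true]
      exact continuousOn_const
    · simp only [horizontal, Matrix.of_apply, hij, if_false, Matrix.mul_apply,
        Matrix.transpose_apply]
      exact continuousOn_finsetSum _ fun k _ => (h k i).continuousOn.mul (hp s k j)
  refine continuousOn_pi.2 fun s => continuousOn_pi.2 fun t => ?_
  simp only [metricMatrix, rotInner, Matrix.trace, Matrix.diag_apply, Matrix.mul_apply,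
    Matrix.of_apply]
  refine ContinuousOn.div_const ?_ _
  exact continuousOn_finsetSum _ fun i _ => continuousOn_finsetSum _ fun k _ =>
    (hh s k i).mul (hh t k i)

/-- The vector with given entries below the diagonal blocks and with the other entries given by a
matrix. -/
def combine (u : Coord c) (T : Matrix (Fin n) (Fin n) ℝ) : Fin n × Fin n → ℝ := fun q =>
  if h : IsLower c q then u ((lowerEquiv c).symm ⟨q, h⟩) else T q.1 q.2

theorem lowPart_combine (u : Coord c) (T : Matrix (Fin n) (Fin n) ℝ) :
    lowPart c (combine u T) = u := by
  ext s
  have : IsLower c s.1.swap := s.index_lt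
  simp only [lowPart_apply, combine, this, dif_pos]
  rfl

theorem upPart_combine (u : Coord c) {T : Matrix (Fin n) (Fin n) ℝ}
    (hT : T.BlockTriangular c.index) : toMat (upPart c (combine u T)) = T := by
  ext i j
  rw [toMat, Matrix.of_apply, upPart_apply]
  by_cases h : IsLower c (i, j)
  · rw [if_pos h, hT h]
  · simp [combine, h]

theorem continuous_combine :
    Continuous fun p : Coord c × Matrix (Fin n) (Fin n) ℝ => combine p.1 p.2 := by
  refine continuous_pi fun q => ?_
  by_cases h : IsLower c q
  · simp only [combine, h, dif_pos]
    exact (continuous_apply _).comp continuous_fst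
  · simp only [combine, h, dif_neg, not_false_eq_true]
    exact continuous_snd.matrix_elem _ _

/-- If `A = Q T` has the flag of `ψ(u)`, then `Q = ψ(u) H` with `H ∈ SG c P`, and `H` is absorbed
into `T`. -/
theorem chartMap_image (φ : LocalParam c P) (B : Set (Coord c)) :
    chartMap φ.lift '' {z | lowPart c z ∈ B ∧ toMat (upPart c z) ∈ Tri c P} =
      {z | 0 < (toMat z).det ∧ flagOf c P (toMat z) ∈ (fun u => proj c P (φ.lift u)) '' B} := by
  ext z
  constructor
  · rintro ⟨z, ⟨hB, hT⟩, rfl⟩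
    rw [mem_ofPred_eq, toMat_chartMap, flagOf_mul _ hT, Matrix.det_mul, det_SO, one_mul]
    exact ⟨det_pos_of_mem_Tri hT, _, hB, rfl⟩
  · rintro ⟨hdet, u, hu, hz⟩
    obtain ⟨Q, T, hT, hA⟩ := exists_SO_mul_Tri (c := c) (P := P) hdet
    rw [hA, flagOf_mul Q hT] at hz
    have hH := proj_eq_proj.1 hz
    have hT' : ((φ.lift u)⁻¹ * Q).1 * T ∈ Tri c P := SG_mul_mem_Tri hH hT
    have hA' : toMat z = (φ.lift u).1 * (((φ.lift u)⁻¹ * Q).1 * T) := by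
      rw [← mul_assoc, ← Submonoid.coe_mul, mul_inv_cancel_left, hA]
    set T' := ((φ.lift u)⁻¹ * Q).1 * T
    have hlow := lowPart_combine u T'
    have hup := upPart_combine u hT'.1
    refine ⟨combine u T', ⟨by rw [hlow]; exact hu, by rw [hup]; exact hT'⟩, ?_⟩
    ext q
    have := congrFun (congrFun hA' q.1) q.2
    rw [chartMap, hlow, hup, ← this]
    rfl

theorem eq_of_lowPart_upPart {z z' : Fin n × Fin n → ℝ} (h : lowPart c z = lowPart c z')
    (h' : upPart c z = upPart c z') : z = z' := by
  ext q
  by_cases hq : IsLower c q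
  · exact congrFun h ((lowerEquiv c).symm ⟨q, hq⟩)
  · simpa [upPart_apply, hq] using congrFun h' q

theorem injOn_chartMap (φ : LocalParam c P) {B : Set (Coord c)} (hB : B ⊆ φ.source) :
    InjOn (chartMap φ.lift) {z | lowPart c z ∈ B ∧ toMat (upPart c z) ∈ Tri c P} := by
  rintro z ⟨hz, hT⟩ z' ⟨hz', hT'⟩ h
  have h1 : (φ.lift (lowPart c z)).1 * toMat (upPart c z) =
      (φ.lift (lowPart c z')).1 * toMat (upPart c z') := by
    rw [← toMat_chartMap, h, toMat_chartMap]
  have h2 : lowPart c z = lowPart c z' :=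
    φ.injOn (hB hz) (hB hz') (proj_eq_of_mul_eq hT hT' h1)
  refine eq_of_lowPart_upPart h2 ?_
  rw [h2] at h1
  have h3 := congrArg ((φ.lift (lowPart c z')).1ᵀ * ·) h1
  simp only [← mul_assoc, transpose_mul_SO, one_mul] at h3
  ext q
  exact congrFun (congrFun h3 q.1) q.2

/-- The set is the injective image of `B × Tri c P`; the Jacobian and the Gaussian density both
split into a factor in `u` and a factor in `T`. -/
theorem gauss_flagOf_preimage (φ : LocalParam c P) {B : Set (Coord c)} (hB : B ⊆ φ.source)
    (hBm : MeasurableSet B) :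
    gauss (Fin n × Fin n)
      {z | 0 < (toMat z).det ∧ flagOf c P (toMat z) ∈ (fun u => proj c P (φ.lift u)) '' B} =
      (∫⁻ u in B, ENNReal.ofReal (√(metricMatrix c φ.lift u).det)) *
        triangularMass c.index P (tailCard c) := by
  set D : Set (Fin n × Fin n → ℝ) := {z | lowPart c z ∈ B ∧ toMat (upPart c z) ∈ Tri c P}
  have hTri : MeasurableSet {z : Fin n × Fin n → ℝ | toMat (upPart c z) ∈ Tri c P} := by
    have h := (measurePreserving_blockDet c.index).measurable
    simp only [mem_Tri_upPart, Set.ofPred_forall]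
    refine Finset.measurableSet_biInter _ fun α _ => ?_
    exact measurableSet_lt measurable_const (Finset.measurable_prod _ fun j _ =>
      (measurable_pi_apply j).comp h)
  have hD : MeasurableSet D := ((lowPart c).continuous.measurable hBm).inter hTri
  have hderiv : ∀ z ∈ D, HasFDerivWithinAt (chartMap φ.lift) (chartDeriv φ.lift z) D z :=
    fun z hz => (hasFDerivAt_chartMap fun i j =>
      φ.differentiableAt (hB hz.1) i j).hasFDerivWithinAt
  have hinj : InjOn (chartMap φ.lift) D := injOn_chartMap φ hB
  have hF : AEMeasurable (B.indicator fun u =>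
      ENNReal.ofReal (√(metricMatrix c φ.lift u).det)) := by
    rw [aemeasurable_indicator_iff hBm]
    have hc : ContinuousOn (fun u => (metricMatrix c φ.lift u).det) B :=
      (Continuous.matrix_det continuous_id).comp_continuousOn
        ((continuousOn_metricMatrix φ.isOpen_source φ.smooth).mono hB)
    exact (hc.aemeasurable hBm).sqrt.ennreal_ofReal
  rw [← chartMap_image, gauss, withDensity_apply _ (measurable_image_of_fderivWithin hD hderiv hinj),
    lintegral_image_eq_lintegral_abs_det_fderiv_mul volume hD hderiv hinj,
    ← lintegral_indicator hBm, ← lintegral_mul_blockWeight hF, ← lintegral_indicator hD]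
  refine lintegral_congr fun z => ?_
  by_cases hz : z ∈ D
  · have hz' : lowPart c z ∈ B := hz.1
    rw [indicator_of_mem hz, indicator_of_mem hz', abs_det_chartDeriv fun i j =>
      φ.differentiableAt (hB hz.1) i j, gaussDensity_chartMap, blockWeight_of_mem hz.2,
      ENNReal.ofReal_mul (Real.sqrt_nonneg _)]
    ring
  · rw [indicator_of_notMem hz]
    by_cases hz' : lowPart c z ∈ B
    -- With `u ∈ B`, being outside `D` means that a sign condition fails.
    · have : blockWeight c P z = 0 := if_neg fun h => hz ⟨hz', mem_Tri_upPart.2 h⟩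
      rw [this, mul_zero, mul_zero]
    · rw [indicator_of_notMem hz', zero_mul]

end ChangeOfVariables

/-! ### The volume measure and its total mass -/

section Volume

/-- The volume measure of the flag manifold, as a normalized image of the Gaussian measure. -/
def flagVolume : Measure (Flag c P) :=
  (triangularMass c.index P (tailCard c))⁻¹ •
    ((gauss (Fin n × Fin n)).comap (Subtype.val : DetPos n → _)).map
      fun z => flagOf c P (toMat z.1)

theorem measurableSet_detPos : MeasurableSet {z : Fin n × Fin n → ℝ | 0 < (toMat z).det} :=
  measurableSet_lt measurable_const measurable_det_toMat

theorem flagVolume_apply {E : Set (Flag c P)} (hE : MeasurableSet E) :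
    flagVolume c P E = (triangularMass c.index P (tailCard c))⁻¹ *
      gauss (Fin n × Fin n) {z | 0 < (toMat z).det ∧ flagOf c P (toMat z) ∈ E} := by
  have hf : Measurable fun z : DetPos n => flagOf c P (toMat z.1) :=
    (continuous_flagOf c P).measurable
  rw [flagVolume, Measure.smul_apply, smul_eq_mul, Measure.map_apply hf hE,
    comap_subtype_coe_apply measurableSet_detPos]
  congr 2
  ext z
  simp [DetPos, and_comm]

theorem isRiemannianVolume_flagVolume (h0 : triangularMass c.index P (tailCard c) ≠ 0)
    (htop : triangularMass c.index P (tailCard c) ≠ ⊤) :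
    IsRiemannianVolume c P (flagVolume c P) := by
  intro φ B hB hBm
  have hcont : ContinuousOn (fun u => proj c P (φ.lift u)) B :=
    ((continuous_proj c P).comp_continuousOn (continuousOn_lift φ.smooth)).mono hB
  -- Lusin-Souslin: an injective continuous image of a Borel set is Borel.
  have hE : MeasurableSet ((fun u => proj c P (φ.lift u)) '' B) :=
    hBm.image_of_continuousOn_injOn hcont (φ.injOn.mono hB)
  rw [flagVolume_apply c P hE, gauss_flagOf_preimage φ hB hBm, mul_comm, mul_assoc,
    ENNReal.mul_inv_cancel h0 htop, mul_one]

theorem flagVolume_univ (hn : 0 < n) :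
    flagVolume c P univ = (2 * triangularMass c.index P (tailCard c))⁻¹ := by
  rw [flagVolume_apply c P MeasurableSet.univ]
  simp only [mem_univ, and_true]
  rw [gauss_det_pos hn, ENNReal.mul_inv (by simp) (by simp), mul_comm]

end Volume

end

section

variable {n : ℕ} {c : Composition n} {P : Finpartition (Finset.univ : Finset (Fin c.length))}

/-! ### Charts around every point, and uniqueness of the volume -/

section Cayley

/-- The elementary skew-symmetric matrices outside the diagonal blocks. -/
def skewUnit (s : CoordIndex c) : Matrix (Fin n) (Fin n) ℝ :=
  Matrix.single s.1.1 s.1.2 1 - Matrix.single s.1.2 s.1.1 1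

/-- The skew-symmetric matrix with given entries outside the diagonal blocks. -/
def skew (u : Coord c) : Matrix (Fin n) (Fin n) ℝ := ∑ s, u s • skewUnit s

theorem skew_transpose (u : Coord c) : (skew u)ᵀ = -skew u := by
  simp [skew, skewUnit, Matrix.transpose_sum, ← Finset.sum_neg_distrib, ← smul_neg]

theorem skew_zero : skew (0 : Coord c) = 0 := by simp [skew]

theorem lowerEntries_skewUnit :
    lowerEntries (fun s : CoordIndex c => (2 : ℝ) • skewUnit s) = (-2 : ℝ) • 1 := by
  ext p s
  have h1 : ¬(s.1.1 = p.1.2 ∧ s.1.2 = p.1.1) := by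
    rintro ⟨h, h'⟩
    have := s.2.1
    rw [h, h'] at this
    exact lt_asymm this p.2.1
  have h2 : (s.1.2 = p.1.2 ∧ s.1.1 = p.1.1) ↔ p = s := by
    rw [Subtype.ext_iff, Prod.ext_iff]
    exact ⟨fun h => ⟨h.2.symm, h.1.symm⟩, fun h => ⟨h.2.symm, h.1.symm⟩⟩
  simp only [lowerEntries, skewUnit, Matrix.of_apply, Matrix.smul_apply, Matrix.sub_apply,
    Matrix.single_apply, h1, h2, if_false, Matrix.one_apply, smul_eq_mul]
  split_ifs <;> norm_num

/-- If `v = X v` with `X` skew-symmetric, then `v ⬝ᵥ v = v ⬝ᵥ X v = 0`. -/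
theorem det_one_sub_skew_ne_zero (u : Coord c) : (1 - skew u).det ≠ 0 := by
  intro h
  obtain ⟨v, hv, h0⟩ := Matrix.exists_mulVec_eq_zero_iff.2 h
  rw [Matrix.sub_mulVec, Matrix.one_mulVec, sub_eq_zero] at h0
  have h1 : v ⬝ᵥ (skew u *ᵥ v) = -(v ⬝ᵥ (skew u *ᵥ v)) := by
    conv_lhs => rw [Matrix.dotProduct_mulVec, ← Matrix.mulVec_transpose, skew_transpose,
      Matrix.neg_mulVec, neg_dotProduct, dotProduct_comm]
  rw [← h0] at h1
  exact hv (dotProduct_self_eq_zero.1 (by linarith))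

/-- The Cayley transform `(1 - X)⁻¹ (1 + X)`. -/
def cayleyMatrix (u : Coord c) : Matrix (Fin n) (Fin n) ℝ := (1 - skew u)⁻¹ * (1 + skew u)

theorem one_sub_mul_cayleyMatrix (u : Coord c) :
    (1 - skew u) * cayleyMatrix u = 1 + skew u := by
  rw [cayleyMatrix, ← mul_assoc,
    Matrix.mul_nonsing_inv _ (det_one_sub_skew_ne_zero u).isUnit, one_mul]

theorem one_sub_transpose (u : Coord c) : (1 - skew u)ᵀ = 1 + skew u := by
  rw [Matrix.transpose_sub, Matrix.transpose_one, skew_transpose, sub_neg_eq_add]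

theorem cayleyMatrix_mem (u : Coord c) :
    cayleyMatrix u ∈ Matrix.specialOrthogonalGroup (Fin n) ℝ := by
  have hd := det_one_sub_skew_ne_zero u
  have hdt : (1 + skew u).det = (1 - skew u).det := by
    rw [← one_sub_transpose, Matrix.det_transpose]
  refine Matrix.mem_specialOrthogonalGroup_iff.2 ⟨(Matrix.mem_orthogonalGroup_iff _ _).2 ?_, ?_⟩
  · have h1 : (1 + skew u)ᵀ = 1 - skew u := by
      rw [← one_sub_transpose, Matrix.transpose_transpose]
    have hcomm : (1 + skew u) * (1 - skew u) = (1 - skew u) * (1 + skew u) := by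
      noncomm_ring
    rw [cayleyMatrix, Matrix.transpose_mul, Matrix.transpose_nonsing_inv, h1, one_sub_transpose,
      mul_assoc, ← mul_assoc (1 + skew u), hcomm, ← mul_assoc, ← mul_assoc,
      Matrix.nonsing_inv_mul _ hd.isUnit, one_mul, Matrix.mul_nonsing_inv _ (hdt ▸ hd).isUnit]
  · have h := congrArg Matrix.det (one_sub_mul_cayleyMatrix u)
    rw [Matrix.det_mul, hdt] at h
    exact mul_left_cancel₀ hd (by rw [h, mul_one])

theorem cayleyMatrix_zero : cayleyMatrix (0 : Coord c) = 1 := by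
  simp [cayleyMatrix, skew_zero]

theorem skew_apply (u : Coord c) (i j : Fin n) : skew u i j = ∑ s, u s * skewUnit s i j := by
  simp [skew, Matrix.sum_apply]

theorem contDiff_skew (i j : Fin n) : ContDiff ℝ ∞ fun u : Coord c => skew u i j := by
  simp_rw [skew_apply]
  fun_prop

theorem contDiff_det {E ι : Type*} [NormedAddCommGroup E] [NormedSpace ℝ E] [Fintype ι]
    [DecidableEq ι] {A : E → Matrix ι ι ℝ} (hA : ∀ i j, ContDiff ℝ ∞ fun u => A u i j) :
    ContDiff ℝ ∞ fun u => (A u).det := by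
  simp_rw [Matrix.det_apply]
  exact ContDiff.sum fun σ _ => (contDiff_prod fun i _ => hA _ _).const_smul _

theorem contDiff_inv_apply {E ι : Type*} [NormedAddCommGroup E] [NormedSpace ℝ E] [Fintype ι]
    [DecidableEq ι] {A : E → Matrix ι ι ℝ} (hA : ∀ i j, ContDiff ℝ ∞ fun u => A u i j)
    (hd : ∀ u, (A u).det ≠ 0) (i j : ι) : ContDiff ℝ ∞ fun u => (A u)⁻¹ i j := by
  simp_rw [Matrix.inv_def, Matrix.smul_apply, Ring.inverse_eq_inv, smul_eq_mul,
    Matrix.adjugate_apply]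
  refine ((contDiff_det hA).inv hd).mul (contDiff_det fun k l => ?_)
  by_cases h : k = j
  · subst h
    simpa using contDiff_const
  · simpa [Matrix.updateRow_ne h] using hA k l

theorem contDiff_cayleyMatrix (i j : Fin n) :
    ContDiff ℝ ∞ fun u : Coord c => cayleyMatrix u i j := by
  simp_rw [cayleyMatrix, Matrix.mul_apply]
  refine ContDiff.sum fun k _ => ContDiff.mul ?_ ?_
  · refine contDiff_inv_apply (fun i j => ?_) det_one_sub_skew_ne_zero i k
    exact contDiff_const.sub (contDiff_skew i j)
  · exact contDiff_const.add (contDiff_skew k j)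

theorem fderiv_skew (i j : Fin n) (u : Coord c) (s : CoordIndex c) :
    fderiv ℝ (fun u : Coord c => skew u i j) u (Pi.single s 1) = skewUnit s i j := by
  have h : HasFDerivAt (fun u : Coord c => skew u i j)
      (∑ t, skewUnit t i j • ContinuousLinearMap.proj (R := ℝ) (φ := fun _ => ℝ) t) u := by
    simp_rw [skew_apply]
    exact HasFDerivAt.fun_sum fun t _ =>
      (ContinuousLinearMap.proj (R := ℝ) (φ := fun _ : CoordIndex c => ℝ) t).hasFDerivAt.mul_const _
  rw [h.fderiv]
  simp [Pi.single_apply]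

theorem fderiv_cayleyMatrix_zero (i j : Fin n) (s : CoordIndex c) :
    fderiv ℝ (fun u : Coord c => cayleyMatrix u i j) 0 (Pi.single s 1) = 2 * skewUnit s i j := by
  have hS : ∀ i j, DifferentiableAt ℝ (fun u : Coord c => skew u i j) 0 := fun i j =>
    (contDiff_skew i j).differentiable (by simp) 0
  have hC : ∀ i j, DifferentiableAt ℝ (fun u : Coord c => cayleyMatrix u i j) 0 := fun i j =>
    (contDiff_cayleyMatrix i j).differentiable (by simp) 0
  have h1 : HasFDerivAt (fun u : Coord c => ∑ k, skew u i k * cayleyMatrix u k j)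
      (∑ k, (skew (0 : Coord c) i k • fderiv ℝ (fun u : Coord c => cayleyMatrix u k j) 0 +
        cayleyMatrix (0 : Coord c) k j • fderiv ℝ (fun u : Coord c => skew u i k) 0)) 0 :=
    HasFDerivAt.fun_sum fun k _ => (hS i k).hasFDerivAt.mul (hC k j).hasFDerivAt
  -- The identity `C = 1 + X + X C` is differentiated instead of the matrix inverse; at `X = 0`, `C
  -- = 1` it gives `dC = 2 dX`.
  have h2 : (fun u : Coord c => cayleyMatrix u i j) = fun u =>
      (1 : Matrix (Fin n) (Fin n) ℝ) i j + skew u i j + ∑ k, skew u i k * cayleyMatrix u k j := by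
    ext u
    have := congrFun (congrFun (one_sub_mul_cayleyMatrix u) i) j
    rw [sub_mul, one_mul, Matrix.sub_apply, Matrix.add_apply, sub_eq_iff_eq_add,
      Matrix.mul_apply] at this
    exact this
  have h3 := ((hS i j).hasFDerivAt.const_add ((1 : Matrix (Fin n) (Fin n) ℝ) i j)).fun_add h1
  rw [h2, h3.fderiv]
  simp only [skew_zero, cayleyMatrix_zero, _root_.add_apply, _root_.sum_apply,
    _root_.smul_apply, fderiv_skew, Matrix.zero_apply, Matrix.one_apply]
  simp [two_mul]

/-- The chart of the flag manifold around the image of `Q` given by the Cayley transform. -/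
def cayleyLift (Q : SO n) (u : Coord c) : SO n := Q * ⟨cayleyMatrix u, cayleyMatrix_mem u⟩

theorem cayleyLift_zero (Q : SO n) : cayleyLift Q (0 : Coord c) = Q := by
  refine Subtype.ext ?_
  change Q.1 * cayleyMatrix 0 = Q.1
  rw [cayleyMatrix_zero, mul_one]

theorem cayleyLift_apply (Q : SO n) (u : Coord c) (i j : Fin n) :
    (cayleyLift Q u).1 i j = ∑ k, Q.1 i k * cayleyMatrix u k j := rfl

theorem contDiff_cayleyLift (Q : SO n) (i j : Fin n) :
    ContDiff ℝ ∞ fun u : Coord c => (cayleyLift Q u).1 i j := by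
  simp_rw [cayleyLift_apply]
  exact ContDiff.sum fun k _ => contDiff_const.mul (contDiff_cayleyMatrix k j)

theorem partialDeriv_cayleyLift_zero (Q : SO n) (s : CoordIndex c) :
    partialDeriv c (cayleyLift Q) 0 s = Q.1 * ((2 : ℝ) • skewUnit s) := by
  ext i j
  have h : HasFDerivAt (fun u : Coord c => (cayleyLift Q u).1 i j)
      (∑ k, Q.1 i k • fderiv ℝ (fun u : Coord c => cayleyMatrix u k j) 0) 0 := by
    simp_rw [cayleyLift_apply]
    exact HasFDerivAt.fun_sum fun k _ =>
      ((contDiff_cayleyMatrix k j).differentiable (by simp) 0).hasFDerivAt.const_mul _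
  rw [partialDeriv, Matrix.of_apply, h.fderiv, Matrix.mul_apply]
  simp only [_root_.sum_apply, _root_.smul_apply, fderiv_cayleyMatrix_zero, smul_eq_mul,
    Matrix.smul_apply]

theorem det_metricMatrix_cayleyLift_zero (Q : SO n) :
    (metricMatrix c (cayleyLift Q) 0).det ≠ 0 := by
  rw [metricMatrix_eq fun i j => (contDiff_cayleyLift Q i j).differentiable (by simp) 0]
  have : (fun s : CoordIndex c => (cayleyLift Q (0 : Coord c)).1ᵀ *
      partialDeriv c (cayleyLift Q) 0 s) = fun s => (2 : ℝ) • skewUnit s := by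
    ext1 s
    rw [partialDeriv_cayleyLift_zero, cayleyLift_zero, ← mul_assoc, transpose_mul_SO, one_mul]
  rw [this, lowerEntries_skewUnit, Matrix.det_mul, Matrix.det_transpose, Matrix.det_smul]
  simp

theorem contDiff_chartMap {ψ : Coord c → SO n} (hψ : ∀ i j, ContDiff ℝ ∞ fun u => (ψ u).1 i j) :
    ContDiff ℝ ∞ (chartMap ψ) := by
  refine contDiff_pi.2 fun q => ?_
  simp only [chartMap, Matrix.mul_apply]
  refine ContDiff.sum fun k _ => ContDiff.mul ?_ ?_
  · exact (hψ q.1 k).comp (lowPart c).contDiff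
  · exact ((ContinuousLinearMap.proj (R := ℝ) (φ := fun _ => ℝ) (k, q.2)).comp
      (upPart c)).contDiff

theorem isOpen_mem_Tri : IsOpen {z : Fin n × Fin n → ℝ | toMat (upPart c z) ∈ Tri c P} := by
  simp only [Tri, mem_ofPred_eq, upPart_blockTriangular, true_and, ofPred_forall]
  refine isOpen_biInter_finset fun α _ => isOpen_lt continuous_const ?_
  exact Continuous.matrix_det
    (Continuous.matrix_submatrix (continuous_toMat.comp (upPart c).continuous) _ _)

-- The inverse function theorem is applied to `(u, T) ↦ ψ(u) T` at `(0, 1)`, so that no manifold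
-- structure on the quotient is needed. It gives both the injectivity of `proj ∘ ψ` near `0` and an
-- open set of flags that it covers.
variable (c P) in
theorem exists_localParam (Q : SO n) : ∃ (φ : LocalParam c P) (O : Set (Flag c P)),
    IsOpen O ∧ proj c P Q ∈ O ∧ O ⊆ (fun u => proj c P (φ.lift u)) '' φ.source := by
  set ψ : Coord c → SO n := cayleyLift Q
  have hψ : ∀ i j, ContDiff ℝ ∞ fun u => (ψ u).1 i j := contDiff_cayleyLift Q
  have hψc : Continuous ψ := by
    rw [← continuousOn_univ]
    exact continuousOn_lift fun i j => (hψ i j).contDiffOn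
  have hψd : ∀ u i j, DifferentiableAt ℝ (fun v => (ψ v).1 i j) u := fun u i j =>
    (hψ i j).differentiable (by simp) u
  let z₀ : Fin n × Fin n → ℝ := combine (0 : Coord c) 1
  have hlow : lowPart c z₀ = 0 := lowPart_combine _ _
  have hup : toMat (upPart c z₀) = 1 := upPart_combine _ Matrix.blockTriangular_one
  have hg : Continuous fun u => (metricMatrix c ψ u).det :=
    Continuous.matrix_det (continuousOn_univ.1
      (continuousOn_metricMatrix isOpen_univ fun i j => (hψ i j).contDiffOn))
  have hg0 : (metricMatrix c ψ 0).det ≠ 0 := det_metricMatrix_cayleyLift_zero Q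
  have hdet : (chartDeriv ψ z₀).det ≠ 0 := by
    -- The determinant of a Gram matrix is nonnegative, hence the square of its root.
    have h1 : (metricMatrix c ψ 0).det = √(metricMatrix c ψ 0).det ^ 2 := by
      rw [sqrt_det_metricMatrix (hψd 0), sq_abs, metricMatrix_eq (hψd 0), Matrix.det_mul,
        Matrix.det_transpose, sq]
    rw [← abs_ne_zero, abs_det_chartDeriv (hψd _), hlow]
    refine mul_ne_zero (fun h => hg0 (by rw [h1, h]; simp)) ?_
    refine Finset.prod_ne_zero_iff.2 fun j _ => pow_ne_zero _ (abs_ne_zero.2 ?_)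
    exact blockDet_ne_zero (P := P) (hup ▸ one_mem_Tri) j
  have hstrict : HasStrictFDerivAt (chartMap ψ)
      ((chartDeriv ψ z₀).toContinuousLinearEquivOfDetNeZero hdet :
        (Fin n × Fin n → ℝ) →L[ℝ] (Fin n × Fin n → ℝ)) z₀ :=
    (contDiff_chartMap hψ).contDiffAt.hasStrictFDerivAt' (hasFDerivAt_chartMap (hψd _)) (by simp)
  let e := hstrict.toOpenPartialHomeomorph
  have he : ∀ z, e z = chartMap ψ z := fun z => rfl
  have hz₀ : z₀ ∈ e.source := hstrict.mem_toOpenPartialHomeomorph_source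
  -- For small `u, u'` the point `(u', ψ(u')ᵀ ψ(u))` is close to `(0, 1)`, hence in the domain where
  -- `chartMap` is injective.
  have hpair : Continuous fun p : Coord c × Coord c => combine p.2 ((ψ p.2).1ᵀ * (ψ p.1).1) :=
    continuous_combine.comp (continuous_snd.prodMk
      ((continuous_subtype_val.comp (hψc.comp continuous_snd)).matrix_transpose.matrix_mul
        (continuous_subtype_val.comp (hψc.comp continuous_fst))))
  have hev : ∀ᶠ p : Coord c × Coord c in nhds 0 ×ˢ nhds 0,
      combine p.2 ((ψ p.2).1ᵀ * (ψ p.1).1) ∈ e.source := by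
    rw [← nhds_prod_eq]
    refine hpair.continuousAt.eventually_mem (e.open_source.mem_nhds ?_)
    simpa [transpose_mul_SO] using hz₀
  obtain ⟨t, ht, hte⟩ := (Filter.eventually_prod_self_iff
    (r := fun u u' => combine u' ((ψ u').1ᵀ * (ψ u).1) ∈ e.source)).1 hev
  obtain ⟨U, hUt, hU, h0U⟩ := mem_nhds_iff.1 ht
  have hmap : ∀ u (T : Matrix (Fin n) (Fin n) ℝ), T.BlockTriangular c.index →
      toMat (chartMap ψ (combine u T)) = (ψ u).1 * T := by
    intro u T hT
    rw [toMat_chartMap, lowPart_combine, upPart_combine _ hT]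
  let φ : LocalParam c P :=
    { source := U ∩ {u | (metricMatrix c ψ u).det ≠ 0}
      isOpen_source := hU.inter (isOpen_ne_fun hg continuous_const)
      lift := ψ
      smooth := fun i j => (hψ i j).contDiffOn
      injOn := by
        rintro u ⟨hu, -⟩ u' ⟨hu', -⟩ h
        -- Two parameters of the same flag differ by some `H ∈ SG c P`, which is block triangular;
        -- then `(u', H)` and `(u, 1)` have the same product, so `u' = u`.
        have hH : (ψ u')⁻¹ * ψ u ∈ SG c P := proj_eq_proj.1 h.symm
        have h1 : combine u' ((ψ u').1ᵀ * (ψ u).1) ∈ e.source := hte _ (hUt hu) _ (hUt hu')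
        have h2 : combine u (1 : Matrix (Fin n) (Fin n) ℝ) ∈ e.source := by
          have := hte _ (hUt hu) _ (hUt hu)
          rwa [transpose_mul_SO] at this
        have h3 : toMat (chartMap ψ (combine u' ((ψ u').1ᵀ * (ψ u).1))) =
            toMat (chartMap ψ (combine u 1)) := by
          rw [hmap u' ((ψ u').1ᵀ * (ψ u).1) hH.1.blockTriangular, hmap _ _ Matrix.blockTriangular_one, ← mul_assoc,
            mul_transpose_SO, one_mul, mul_one]
        have h4 := e.injOn h1 h2 (funext fun q => congrFun (congrFun h3 q.1) q.2)
        have h5 := congrArg (lowPart c) h4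
        rw [lowPart_combine, lowPart_combine] at h5
        exact h5.symm
      immersion := fun u hu => hu.2 }
  -- Rotations in the open image of `W` have the form `ψ(u) T` with `T ∈ Tri c P`, so they have the
  -- flag of `ψ(u)`; their flags form the required neighbourhood.
  let W : Set (Fin n × Fin n → ℝ) :=
    e.source ∩ (lowPart c ⁻¹' φ.source ∩ {z | toMat (upPart c z) ∈ Tri c P})
  have hW : IsOpen W := e.open_source.inter
    ((φ.isOpen_source.preimage (lowPart c).continuous).inter isOpen_mem_Tri)
  have hWim : IsOpen (e '' W) := e.isOpen_image_of_subset_source hW inter_subset_left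
  let vec : SO n → Fin n × Fin n → ℝ := fun R q => R.1 q.1 q.2
  have hvec : Continuous vec := continuous_pi fun q => continuous_subtype_val.matrix_elem _ _
  refine ⟨φ, proj c P '' (vec ⁻¹' (e '' W)), (isOpenQuotientMap_proj c P).isOpenMap _
    (hWim.preimage hvec), ⟨Q, ?_, rfl⟩, ?_⟩
  · refine ⟨z₀, ⟨hz₀, ?_, ?_⟩, ?_⟩
    · rw [mem_preimage, hlow]
      exact ⟨h0U, hg0⟩
    · rw [mem_ofPred_eq, hup]
      exact one_mem_Tri
    · have h := hmap 0 1 Matrix.blockTriangular_one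
      rw [mul_one, show ψ 0 = Q from cayleyLift_zero Q] at h
      exact funext fun q => congrFun (congrFun h q.1) q.2
  · rintro _ ⟨R, ⟨z, ⟨-, hzU, hzT⟩, hzR⟩, rfl⟩
    refine ⟨lowPart c z, hzU, proj_eq_of_mul_eq hzT (one_mem_Tri (P := P)) ?_⟩
    rw [mul_one]
    change (ψ (lowPart c z)).1 * toMat (upPart c z) = R.1
    rw [← toMat_chartMap, ← he, hzR]
    rfl

end Cayley

/-- By compactness finitely many chart images cover the space, and each Borel set inside one is the
image of a Borel set of parameters, where the density prescribes the measure. -/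
theorem IsRiemannianVolume.eq {μ ν : Measure (Flag c P)} (hμ : IsRiemannianVolume c P μ)
    (hν : IsRiemannianVolume c P ν) : μ = ν := by
  have h : ∀ x : Flag c P, ∃ (φ : LocalParam c P) (O : Set (Flag c P)),
      IsOpen O ∧ x ∈ O ∧ O ⊆ (fun u => proj c P (φ.lift u)) '' φ.source := by
    intro x
    obtain ⟨Q, rfl⟩ := (isOpenQuotientMap_proj c P).surjective x
    exact exists_localParam c P Q
  choose φ O hO hx hsub using h
  obtain ⟨t, ht⟩ := isCompact_univ.elim_nhds_subcover O fun x _ => (hO x).mem_nhds (hx x)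
  refine (Measure.ext_iff_of_biUnion_eq_univ (S := (t : Set (Flag c P))) (s := O)
    t.countable_toSet (univ_subset_iff.1 (by simpa using ht.2))).2 fun x _ => ?_
  refine Measure.ext fun E hE => ?_
  rw [Measure.restrict_apply hE, Measure.restrict_apply hE]
  have hcont : ContinuousOn (fun u => proj c P ((φ x).lift u)) (φ x).source :=
    (continuous_proj c P).comp_continuousOn (continuousOn_lift (φ x).smooth)
  have hB : MeasurableSet ((φ x).source ∩ (fun u => proj c P ((φ x).lift u)) ⁻¹' (E ∩ O x)) := by
    have h := (φ x).isOpen_source.measurableSet.subtype_image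
      ((continuousOn_iff_continuous_domRestrict.1 hcont).measurable
        (hE.inter (hO x).measurableSet))
    convert h using 1
    ext u
    simp
    tauto
  have him : (fun u => proj c P ((φ x).lift u)) ''
      ((φ x).source ∩ (fun u => proj c P ((φ x).lift u)) ⁻¹' (E ∩ O x)) = E ∩ O x := by
    rw [image_inter_preimage]
    exact inter_eq_right.2 fun y hy => hsub x hy.2
  rw [← him, hμ _ _ inter_subset_left hB, hν _ _ inter_subset_left hB]

end

/-! ### Conjugate partitions and the telescoping product -/

section Combinatorics

theorem card_filter_get (l : List ℕ) (p : ℕ → Prop) [DecidablePred p] :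
    (Finset.univ.filter fun a : Fin l.length => p (l.get a)).card = l.countP p := by
  rw [← Multiset.coe_countP]
  conv_rhs => rw [← List.ofFn_get l, ← Fin.univ_val_map, Multiset.countP_map]
  rfl

theorem colLen_ofRowLens {w : List ℕ} (hw : w.SortedGE) (j : ℕ) :
    (YoungDiagram.ofRowLens w hw).colLen j = w.countP (j < ·) := by
  rw [YoungDiagram.colLen_eq_card, ← card_filter_get, ← Finset.card_image_of_injective
    (Finset.univ.filter fun a : Fin w.length => j < w.get a)
    (f := fun a : Fin w.length => ((a : ℕ), j)) fun a b h => Fin.ext (Prod.ext_iff.1 h).1]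
  congr 1
  ext ⟨a, b⟩
  rw [YoungDiagram.mem_col_iff, YoungDiagram.mem_ofRowLens]
  simp only [Finset.mem_image, Finset.mem_filter, Finset.mem_univ, true_and, Prod.mk.injEq]
  constructor
  · rintro ⟨⟨h, h'⟩, rfl⟩
    exact ⟨⟨a, h⟩, h', rfl, rfl⟩
  · rintro ⟨a, h, rfl, rfl⟩
    exact ⟨⟨a.2, h⟩, rfl⟩

variable {n : ℕ} (c : Composition n)

theorem conjPart_eq_card {i : ℕ} (hi : 0 < i) :
    conjPart c i = (Finset.univ.filter fun j : Fin c.length => i ≤ c.blocksFun j).card := by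
  rw [conjPart, YoungDiagram.rowLen_transpose, youngDiagram, colLen_ofRowLens,
    (List.perm_insertionSort _ _).countP_eq, ← card_filter_get]
  congr 1
  ext j
  simp only [Finset.mem_filter, Finset.mem_univ, true_and]
  rw [Composition.blocksFun]
  -- Column `i - 1` counts the rows with `i - 1 < λ_j`, which for `i ≥ 1` is `i ≤ λ_j`.
  omega

/-- Interchange the products: `x i` occurs once for every block of size at least `i`. -/
theorem prod_blocks_eq_multiPow (x : ℕ → ℝ) :
    ∏ j, ∏ i ∈ Finset.Icc 1 (c.blocksFun j), x i =
      multiPow n x fun i => (conjPart c i : ℤ) := by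
  have h : ∀ j, ∏ i ∈ Finset.Icc 1 (c.blocksFun j), x i =
      ∏ i ∈ Finset.Icc 1 n, if i ≤ c.blocksFun j then x i else 1 := by
    intro j
    rw [← Finset.prod_filter]
    congr 1
    ext i
    have := c.blocksFun_le j
    simp only [Finset.mem_filter, Finset.mem_Icc]
    omega
  simp_rw [h]
  rw [Finset.prod_comm, multiPow]
  refine Finset.prod_congr rfl fun i hi => ?_
  rw [conjPart_eq_card c (Finset.mem_Icc.1 hi).1, zpow_natCast, ← Finset.prod_filter,
    Finset.prod_const]

/-- The coordinates in a block, listed by the size of the block. -/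
def blockEquiv (j : Fin c.length) : Fin (c.blocksFun j) ≃ {i : Fin n // c.index i = j} :=
  Equiv.ofBijective (fun k => ⟨c.embedding j k, c.index_embedding j k⟩) <| by
    refine ⟨fun k l h => (c.embedding j).injective (congrArg Subtype.val h), fun i => ?_⟩
    obtain ⟨k, hk⟩ := c.mem_range_embedding_iff'.2 i.2.symm
    exact ⟨k, Subtype.ext hk⟩

theorem index_surjective : Function.Surjective c.index := fun j =>
  ⟨c.embedding j ⟨0, c.one_le_blocksFun j⟩, c.index_embedding _ _⟩

/-- The number of coordinates that lie in the blocks from the `t`-th one on. -/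
def cardFrom (t : ℕ) : ℕ := (Finset.univ.filter fun i : Fin n => t ≤ (c.index i : ℕ)).card

theorem tailCard_eq (j : Fin c.length) : tailCard c j = cardFrom c (j + 1) := by
  rw [tailCard, Fintype.card_subtype, cardFrom]
  rfl

theorem blocksFun_add_tailCard (j : Fin c.length) :
    c.blocksFun j + tailCard c j = cardFrom c j := by
  have h1 : c.blocksFun j = (Finset.univ.filter fun i : Fin n => c.index i = j).card := by
    rw [← Fintype.card_subtype, ← Fintype.card_congr (blockEquiv c j), Fintype.card_fin]
  rw [h1, tailCard, Fintype.card_subtype, ← Finset.card_union_of_disjoint, cardFrom]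
  · congr 1
    ext i
    simp only [Finset.mem_union, Finset.mem_filter, Finset.mem_univ, true_and, Fin.ext_iff,
      Fin.lt_def]
    omega
  · rw [Finset.disjoint_filter]
    rintro i - rfl
    exact lt_irrefl _

theorem prod_Icc_pos {m : ℕ} : 0 < ∏ i ∈ Finset.Icc 1 m, sphereVol i :=
  Finset.prod_pos fun _ hi => sphereVol_pos (Finset.mem_Icc.1 hi).1

theorem prod_Icc_div (l m : ℕ) :
    ∏ i ∈ Finset.Icc 1 l, sphereVol i / sphereVol (i + m) =
      (∏ i ∈ Finset.Icc 1 l, sphereVol i) * ((∏ i ∈ Finset.Icc 1 m, sphereVol i) /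
        ∏ i ∈ Finset.Icc 1 (l + m), sphereVol i) := by
  induction l with
  | zero => simp [div_self (prod_Icc_pos (m := m)).ne']
  | succ l ih =>
    rw [Finset.prod_Icc_succ_top (by omega), Finset.prod_Icc_succ_top (by omega), ih,
      show l + 1 + m = l + m + 1 by omega, Finset.prod_Icc_succ_top (by omega)]
    have h1 := (prod_Icc_pos (m := l + m)).ne'
    have h2 := (sphereVol_pos (l + m).succ_pos).ne'
    field_simp

/-- If `N_t` coordinates lie in the blocks from `t` on, the `j`-th factor is `W (j+1) / W j` with `W
t = V_1 ⋯ V_{N_t}`. The product telescopes from `N_0 = n` to `N_k = 0`. -/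
theorem prod_tailCard :
    ∏ j : Fin c.length, ((∏ i ∈ Finset.Icc 1 (tailCard c j), sphereVol i) /
      ∏ i ∈ Finset.Icc 1 (c.blocksFun j + tailCard c j), sphereVol i) =
      (∏ i ∈ Finset.Icc 1 n, sphereVol i)⁻¹ := by
  let W : ℕ → ℝ := fun t => ∏ i ∈ Finset.Icc 1 (cardFrom c t), sphereVol i
  have hW : ∀ t, W t ≠ 0 := fun t => prod_Icc_pos.ne'
  have h0 : W 0 = ∏ i ∈ Finset.Icc 1 n, sphereVol i := by simp [W, cardFrom]
  have hk : W c.length = 1 := by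
    have : cardFrom c c.length = 0 := by
      simp [cardFrom, Finset.filter_eq_empty_iff, Fin.is_lt]
    simp [W, this]
  have htel : ∀ k, ∏ t ∈ Finset.range k, W (t + 1) / W t = W k / W 0 := by
    intro k
    induction k with
    | zero => simp [hW]
    | succ k ih =>
      rw [Finset.prod_range_succ, ih]
      have := hW k
      have := hW 0
      field_simp
  simp_rw [blocksFun_add_tailCard, tailCard_eq]
  rw [← h0, ← one_div, ← hk, ← htel]
  exact Fin.prod_univ_eq_prod_range (fun t => W (t + 1) / W t) c.length

variable (P : Finpartition (Finset.univ : Finset (Fin c.length)))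

theorem two_pow_mul_triangularMass_tailCard :
    2 ^ P.parts.card * triangularMass c.index P (tailCard c) =
      ENNReal.ofReal ((∏ j, ∏ i ∈ Finset.Icc 1 (c.blocksFun j), sphereVol i) /
        ∏ i ∈ Finset.Icc 1 n, sphereVol i) := by
  rw [two_pow_mul_triangularMass (index_surjective c), div_eq_mul_inv, ← prod_tailCard c,
    ← Finset.prod_mul_distrib, ENNReal.ofReal_prod_of_nonneg]
  · refine Finset.prod_congr rfl fun j _ => ?_
    rw [← detLaw_congr (blockEquiv c j), lintegral_detPow_detLaw, prod_Icc_div]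
  · exact fun j _ => mul_nonneg prod_Icc_pos.le (div_nonneg prod_Icc_pos.le prod_Icc_pos.le)

theorem triangularMass_tailCard : triangularMass c.index P (tailCard c) =
    ENNReal.ofReal ((∏ j, ∏ i ∈ Finset.Icc 1 (c.blocksFun j), sphereVol i) /
        (∏ i ∈ Finset.Icc 1 n, sphereVol i) / 2 ^ P.parts.card) := by
  have h2 : (2 : ENNReal) ^ P.parts.card = ENNReal.ofReal (2 ^ P.parts.card) := by
    rw [ENNReal.ofReal_pow zero_le_two, ENNReal.ofReal_ofNat]
  rw [ENNReal.ofReal_div_of_pos (by positivity), ← two_pow_mul_triangularMass_tailCard, ← h2,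
    mul_comm, ENNReal.mul_div_cancel_right (by simp) (by simp)]

theorem triangularMass_pos : 0 < (∏ j, ∏ i ∈ Finset.Icc 1 (c.blocksFun j), sphereVol i) /
    (∏ i ∈ Finset.Icc 1 n, sphereVol i) / 2 ^ P.parts.card :=
  div_pos (div_pos (Finset.prod_pos fun _ _ => prod_Icc_pos) prod_Icc_pos) (by positivity)

theorem flagVolume_univ_eq (hn : 0 < n) : flagVolume c P univ =
    ENNReal.ofReal ((2 : ℝ) ^ ((P.parts.card : ℤ) - 1) *
      ((∏ i ∈ Finset.Icc 1 n, sphereVol i) /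
        ∏ j : Fin c.length, ∏ i ∈ Finset.Icc 1 (c.blocksFun j), sphereVol i)) := by
  have h2 : (2 : ENNReal) = ENNReal.ofReal 2 := (ENNReal.ofReal_ofNat 2).symm
  rw [flagVolume_univ c P hn, triangularMass_tailCard, h2, ← ENNReal.ofReal_mul zero_le_two,
    ← ENNReal.ofReal_inv_of_pos (mul_pos two_pos (triangularMass_pos c P))]
  congr 1
  rw [zpow_sub_one₀ two_ne_zero, zpow_natCast, mul_inv, inv_div, div_div_eq_mul_div]
  ring

end Combinatorics

end PartialFlag

end

theorem mainTheorem3 (n : ℕ) (hn : 0 < n) (c : Composition n)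
    (P : Finpartition (Finset.univ : Finset (Fin c.length))) :
    ∃ μ : MeasureTheory.Measure (PartialFlag.Flag c P),
      PartialFlag.IsRiemannianVolume c P μ ∧
      (∀ ν : MeasureTheory.Measure (PartialFlag.Flag c P),
        PartialFlag.IsRiemannianVolume c P ν → ν = μ) ∧
      μ Set.univ = ENNReal.ofReal
        ((2 : ℝ) ^ ((P.parts.card : ℤ) - 1) *
          ((∏ i ∈ Finset.Icc 1 n, PartialFlag.sphereVol i) /
            ∏ j : Fin c.length, ∏ i ∈ Finset.Icc 1 (c.blocksFun j), PartialFlag.sphereVol i)) ∧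
      μ Set.univ = ENNReal.ofReal
        ((2 : ℝ) ^ ((P.parts.card : ℤ) - 1) *
          (PartialFlag.multiPow n PartialFlag.sphereVol (fun _ => 1) /
            PartialFlag.multiPow n PartialFlag.sphereVol
              (fun i => (PartialFlag.conjPart c i : ℤ)))) ∧
      μ Set.univ = ENNReal.ofReal
        ((2 : ℝ) ^ ((P.parts.card : ℤ) - 1) *
          PartialFlag.multiPow n PartialFlag.sphereVol
            (fun i => 1 - (PartialFlag.conjPart c i : ℤ))) := by
  have hK := PartialFlag.triangularMass_tailCard c P
  have hvol : PartialFlag.IsRiemannianVolume c P (PartialFlag.flagVolume c P) := by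
    refine PartialFlag.isRiemannianVolume_flagVolume c P ?_ ?_
    · rw [hK]
      exact (ENNReal.ofReal_pos.2 (PartialFlag.triangularMass_pos c P)).ne'
    · rw [hK]
      exact ENNReal.ofReal_ne_top
  have h1 := PartialFlag.flagVolume_univ_eq c P hn
  have hone : PartialFlag.multiPow n PartialFlag.sphereVol (fun _ => 1) =
      ∏ i ∈ Finset.Icc 1 n, PartialFlag.sphereVol i := by simp [PartialFlag.multiPow]
  have hsub : PartialFlag.multiPow n PartialFlag.sphereVol
      (fun i => 1 - (PartialFlag.conjPart c i : ℤ)) =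
      PartialFlag.multiPow n PartialFlag.sphereVol (fun _ => 1) /
        PartialFlag.multiPow n PartialFlag.sphereVol
          (fun i => (PartialFlag.conjPart c i : ℤ)) := by
    simp only [PartialFlag.multiPow]
    rw [← Finset.prod_div_distrib]
    exact Finset.prod_congr rfl fun i hi =>
      zpow_sub₀ (PartialFlag.sphereVol_pos (Finset.mem_Icc.1 hi).1).ne' _ _
  refine ⟨_, hvol, fun ν hν => hν.eq hvol, h1, ?_, ?_⟩
  · rw [hone, ← PartialFlag.prod_blocks_eq_multiPow, h1]
  · rw [hsub, hone, ← PartialFlag.prod_blocks_eq_multiPow, h1]
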